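/- Let $d\ge 3$ and let $\Sigma$ be a simply connected space form of dimension $d$, realized as one of the following hypersurfaces in $\mathbb R^{d+1}$ with coordinates $x=(x_0,\dots,x_d)$, with the metric induced by the quadratic form $\langle Gx,x\rangle$: $\{x_0=1\}$ with $G=\operatorname{diag}(0,1,\dots,1)$ (Euclidean space); $\{\langle Gx,x\rangle=1\}$ with $G=\mathrm{Id}$ (the sphere); $\{\langle Gx,x\rangle=-1,\ x_0>0\}$ with $G=\operatorname{diag}(-1,1,\dots,1)$ (hyperbolic space). Its geodesics are its non-empty intersections with two-dimensional vector subspaces of $\mathbb R^{d+1}$. A quadric in $\Sigma$ is a hypersurface $\Sigma\cap\{\langle Qx,x\rangle=0\}$ with $Q$ a real symmetric matrix. Two quadrics are confocal if, for one real symmetric matrix $Q$, both belong to the pencil of quadrics $\Sigma\cap\{\langle (Q-\lambda G)^{-1}x,x\rangle=0\}$, where $\lambda\in\mathbb R$ and $\det(Q-\lambda G)\ne0$. Let $U\subset\Sigma$ be a quadric with non-degenerate second fundamental form (at each of its points). For $y\in\Sigma\setminus U$ let $\widetilde K_y\subset T_y\Sigma$ be the cone of vectors tangent at $y$ to the geodesics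 through $y$ that are tangent to $U$. Let $S\subset\Sigma$ be a germ of $C^2$-smooth hypersurface at a point $B\notin U$ with non-degenerate second fundamental form. Suppose that at least one geodesic through $B$ is tangent to $U$, and that for every $y\in S$ (close to $B$) the cone $\widetilde K_y$ is symmetric with respect to the hyperplane $T_yS$. Then $S$ is a quadric confocal to $U$: there is a quadric confocal to $U$ whose germ at $B$ coincides with $S$. -/

import Mathlib

open Matrix Topology Filter

/-- The three simply connected space forms (up to a constant factor in the metric). -/
inductive SpaceForm where
  | euclidean
  | spherical
  | hyperbolic

namespace SpaceForm

/-- The ambient vector space `ℝ^{d+1}` with coordinates `x_0, …, x_d`. Its norm is used only through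
the topology and the notion of differentiability; all metric notions come from `gramMatrix`. -/
abbrev Ambient (d : ℕ) : Type := Fin (d + 1) → ℝ

/-- The coefficient of `x_0^2` in the quadratic form `<Gx, x>`. -/
def timeCoeff : SpaceForm → ℝ
  | euclidean => 0
  | spherical => 1
  | hyperbolic => -1

/-- The matrix `G`: `diag(0,1,…,1)`, the identity, or `diag(-1,1,…,1)`. -/
def gramMatrix (M : SpaceForm) (d : ℕ) : Matrix (Fin (d + 1)) (Fin (d + 1)) ℝ :=
  Matrix.diagonal (fun i => if i = 0 then M.timeCoeff else 1)

/-- The bilinear form `<Gv, w>`; on tangent vectors of the space form it is the Riemannian metric. -/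
def metric (M : SpaceForm) {d : ℕ} (v w : Ambient d) : ℝ := v ⬝ᵥ (M.gramMatrix d *ᵥ w)

/-- The `d`-dimensional space form as a hypersurface in `ℝ^{d+1}`:
`{x_0 = 1}`, or `{<Gx,x> = 1}`, or `{<Gx,x> = -1, x_0 > 0}`. -/
def carrier : SpaceForm → (d : ℕ) → Set (Ambient d)
  | euclidean, _ => {x | x 0 = 1}
  | spherical, _ => {x | spherical.metric x x = 1}
  | hyperbolic, _ => {x | hyperbolic.metric x x = -1 ∧ 0 < x 0}

/-- The tangent space of the space form at its point `x`. -/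
def tangentSpace : SpaceForm → {d : ℕ} → Ambient d → Set (Ambient d)
  | euclidean, _, _ => {v | v 0 = 0}
  | spherical, _, x => {v | spherical.metric x v = 0}
  | hyperbolic, _, x => {v | hyperbolic.metric x v = 0}

/-- The velocity vectors at `x` of the curves through `x` that lie in `X`.
If `X` is a hypersurface, this is its tangent space `T_x X`. -/
def tangentVectors {d : ℕ} (X : Set (Ambient d)) (x : Ambient d) : Set (Ambient d) :=
  {v | ∃ γ : ℝ → Ambient d, γ 0 = x ∧ HasDerivAt γ v 0 ∧ ∀ᶠ t in 𝓝 (0 : ℝ), γ t ∈ X}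

/-- Near its point `x`, the set `X` is a `C²`-smooth hypersurface of the space form: the zero locus
of a `C²` function whose differential on the tangent space of the space form is non-zero. -/
def IsC2HypersurfaceAt (M : SpaceForm) {d : ℕ} (X : Set (Ambient d)) (x : Ambient d) : Prop :=
  ∃ f : Ambient d → ℝ, ContDiffAt ℝ 2 f x ∧
    (∃ v ∈ M.tangentSpace x, fderiv ℝ f x v ≠ 0) ∧
    ∀ᶠ z in 𝓝[M.carrier d] x, (z ∈ X ↔ f z = 0)

/-- `N` is a `C¹`-smooth field of unit normals to the hypersurface `X` of the space form near `x`. -/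
def IsUnitNormalFieldAt (M : SpaceForm) {d : ℕ} (X : Set (Ambient d)) (x : Ambient d)
    (N : Ambient d → Ambient d) : Prop :=
  ContDiffAt ℝ 1 N x ∧
    ∀ᶠ z in 𝓝[X] x, N z ∈ M.tangentSpace z ∧ M.metric (N z) (N z) = 1 ∧
      ∀ v ∈ tangentVectors X z, M.metric (N z) v = 0

/-- The second fundamental form `II(v, w) = -<∇_v N, w>` at `x` with respect to the unit normal
field `N`. The covariant derivative `∇_v N` is the tangential part of the derivative of `N` in
`ℝ^{d+1}`, and the other part has zero product with the tangent vector `w`. -/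
noncomputable def secondFundamentalForm (M : SpaceForm) {d : ℕ} (N : Ambient d → Ambient d)
    (x v w : Ambient d) : ℝ :=
  -M.metric (fderiv ℝ N x v) w

/-- Near `x` the set `X` is a `C²` hypersurface of the space form, and its second fundamental form
at `x` is a non-degenerate bilinear form on `T_x X`. -/
def HasNondegenerateSecondFormAt (M : SpaceForm) {d : ℕ} (X : Set (Ambient d))
    (x : Ambient d) : Prop :=
  M.IsC2HypersurfaceAt X x ∧ ∃ N : Ambient d → Ambient d, M.IsUnitNormalFieldAt X x N ∧
    ∀ v ∈ tangentVectors X x,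
      (∀ w ∈ tangentVectors X x, M.secondFundamentalForm N x v w = 0) → v = 0

/-- The quadric `Σ ∩ {<Qx, x> = 0}`. -/
def quadric (M : SpaceForm) {d : ℕ} (Q : Matrix (Fin (d + 1)) (Fin (d + 1)) ℝ) :
    Set (Ambient d) :=
  {x | x ∈ M.carrier d ∧ (Q *ᵥ x) ⬝ᵥ x = 0}

/-- `X` is the quadric in the space form that is given by some symmetric matrix. -/
def IsQuadric (M : SpaceForm) {d : ℕ} (X : Set (Ambient d)) : Prop :=
  ∃ Q : Matrix (Fin (d + 1)) (Fin (d + 1)) ℝ, Q.IsSymm ∧ X = M.quadric Q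

/-- `X` is the member with parameter `t` of the pencil of confocal quadrics associated to `Q`. -/
def IsPencilMember (M : SpaceForm) {d : ℕ} (Q : Matrix (Fin (d + 1)) (Fin (d + 1)) ℝ) (t : ℝ)
    (X : Set (Ambient d)) : Prop :=
  IsUnit (Q - t • M.gramMatrix d).det ∧ X = M.quadric (Q - t • M.gramMatrix d)⁻¹

/-- Two quadrics are confocal if they belong to the pencil associated to one symmetric matrix. -/
def AreConfocal (M : SpaceForm) {d : ℕ} (X Y : Set (Ambient d)) : Prop :=
  ∃ Q : Matrix (Fin (d + 1)) (Fin (d + 1)) ℝ, Q.IsSymm ∧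
    ∃ s t : ℝ, M.IsPencilMember Q s X ∧ M.IsPencilMember Q t Y

/-- The geodesics of the space form are its intersections with the two-dimensional vector subspaces
`P` of `ℝ^{d+1}` that meet it, and the tangent line of such a geodesic at its point `A` is the
intersection of `P` with the tangent space of the space form at `A`. The geodesic given by `P` is
tangent to `U` if at some common point `A` its tangent line lies in `T_A U`. -/
def IsTangentGeodesic (M : SpaceForm) {d : ℕ} (P : Submodule ℝ (Ambient d))
    (U : Set (Ambient d)) : Prop :=
  Module.finrank ℝ P = 2 ∧
    ∃ A ∈ M.carrier d, A ∈ P ∧ A ∈ U ∧ ∀ w ∈ P, w ∈ M.tangentSpace A → w ∈ tangentVectors U A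

/-- The cone, in the tangent space of the space form at `y`, of the vectors tangent at `y` to the
geodesics through `y` that are tangent to `U`. It is empty if there are no such geodesics. -/
def circumscribedCone (M : SpaceForm) {d : ℕ} (U : Set (Ambient d)) (y : Ambient d) :
    Set (Ambient d) :=
  {v | v ∈ M.tangentSpace y ∧
    ∃ P : Submodule ℝ (Ambient d), y ∈ P ∧ v ∈ P ∧ M.IsTangentGeodesic P U}

/-- A subset `K` of the tangent space at `y` is symmetric with respect to the hyperplane `H`: it is
preserved by the reflection `a + n ↦ a - n`, where `a ∈ H` and `n` is a tangent vector of the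
space form that is orthogonal to `H`. -/
def IsSymmetricWrt (M : SpaceForm) {d : ℕ} (y : Ambient d) (K H : Set (Ambient d)) : Prop :=
  ∀ a ∈ H, ∀ n ∈ M.tangentSpace y, (∀ b ∈ H, M.metric n b = 0) → (a + n ∈ K ↔ a - n ∈ K)

end SpaceForm

/-! Everything is done linearly in the ambient space. Let `ν` be the conormal of the cone over `S`:
it kills `y` and `T_y S`, `G ν` is the unit normal `n`, and `ν · G ν = 1`. Non-degeneracy of `U`
forces `det Q ≠ 0` (`det_ne_zero_of_nondegenerate`). A geodesic through `y` touches `U` at a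
`Q`-null vector that is `Q`-orthogonal to `y`, so the circumscribed cone consists of null vectors of
`b = coneForm Q y`, whose kernel is the line of `y`.

If `v` and its reflection `v - 2 (ν · v) n` are both null, then `(ν · v) (b n v - b n n (ν · v)) =
0`. This product of two linear forms vanishes on the null cone of `b` near a real tangency point,
and such a cone is irreducible there (`eq_zero_or_eq_zero_of_mul_eq_zero_on_null`), so the second
factor is identically zero. Multiplication by `Q⁻¹` turns this into `Q⁻¹ ν = l G ν + c y`
(`exists_inv_mulVec_conormal_eq`).

Here `l = ν · Q⁻¹ ν`, whose derivative along `S` is zero; hence `l` is a constant `t`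
(`exists_constant_coefficient`). Non-degeneracy of `S` makes `A = Q⁻¹ - t G` invertible
(`exists_pencil_parameter`). Then `A⁻¹ y` is proportional to `ν`, so `A⁻¹ y · y = 0` on `S`. Thus
`S` lies in a quadric of the pencil of `Q⁻¹`, which contains `U` at parameter `0`; both
hypersurfaces are regular at `B` with the same tangent space there, so their germs agree
(`eventually_eq_zero_of_regular`). -/

/-! ### Irreducibility of a real null cone near one of its points. -/

/-- The non-zero locus of a function that restricts on lines to quadratic polynomials with
leading coefficient its value at the direction is dense, as soon as it is non-empty. -/
theorem frequently_ne_zero_of_quadratic {V : Type*} [NormedAddCommGroup V] [NormedSpace ℝ V]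
    {f : V → ℝ} (hf : ∀ x h, ∃ β : ℝ, ∀ t : ℝ, f (x + t • h) = f x + β * t + f h * t ^ 2)
    {h : V} (hh : f h ≠ 0) (x : V) : ∃ᶠ z in 𝓝 x, f z ≠ 0 := by
  obtain ⟨β, hβ⟩ := hf x h
  have hp : (Polynomial.C (f x) + Polynomial.C β * Polynomial.X
      + Polynomial.C (f h) * Polynomial.X ^ 2 : Polynomial ℝ) ≠ 0 := by
    intro h0
    have := congrArg (fun p => Polynomial.coeff p 2) h0
    exact hh (by simpa using this)
  intro hev
  have hc : Tendsto (fun t : ℝ => x + t • h) (𝓝 0) (𝓝 x) := by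
    have : Continuous (fun t : ℝ => x + t • h) := by fun_prop
    simpa using this.tendsto 0
  have h1 : ∀ᶠ t in 𝓝 (0 : ℝ), f (x + t • h) = 0 := by
    filter_upwards [hc.eventually hev] with t ht
    simpa using ht
  apply hp
  apply Polynomial.eq_zero_of_infinite_isRoot
  refine Set.Infinite.mono ?_ (infinite_of_mem_nhds 0 h1)
  intro t ht
  have ht' : f (x + t • h) = 0 := ht
  rw [hβ] at ht'
  simpa [Polynomial.IsRoot] using ht'

/-- If neither function is trivial, the non-zero locus of `f` is open and dense and that of `g` is
dense, so they meet arbitrarily close to `x`. -/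
theorem quadratic_eq_zero_or_eq_zero {V : Type*} [NormedAddCommGroup V] [NormedSpace ℝ V]
    {f g : V → ℝ} (hf : ∀ x h, ∃ β : ℝ, ∀ t : ℝ, f (x + t • h) = f x + β * t + f h * t ^ 2)
    (hg : ∀ x h, ∃ β : ℝ, ∀ t : ℝ, g (x + t • h) = g x + β * t + g h * t ^ 2)
    (hfc : Continuous f) {x : V} (h : ∀ᶠ z in 𝓝 x, f z * g z = 0) :
    (∀ z, f z = 0) ∨ ∀ z, g z = 0 := by
  by_contra! hcon
  obtain ⟨⟨a, ha⟩, b, hb⟩ := hcon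
  obtain ⟨z, hz, hz'⟩ := ((frequently_ne_zero_of_quadratic hf ha x).and_eventually
    h.eventually_nhds).exists
  obtain ⟨w, hw, hw', hw''⟩ := ((frequently_ne_zero_of_quadratic hg hb z).and_eventually
    (hz'.and (hfc.continuousAt.eventually_ne hz))).exists
  exact (mul_ne_zero hw'' hw) hw'

theorem exists_mem_ker_inf_ker_notMem {V : Type*} [AddCommGroup V] [Module ℝ V]
    [FiniteDimensional ℝ V] (φ ψ : V →ₗ[ℝ] ℝ) (W : Submodule ℝ V)
    (hW : Module.finrank ℝ W + 2 < Module.finrank ℝ V) :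
    ∃ u, φ u = 0 ∧ ψ u = 0 ∧ u ∉ W := by
  by_contra! hcon
  have hle : LinearMap.ker (φ.prod ψ) ≤ W := by
    intro u hu
    simp [LinearMap.mem_ker] at hu
    exact hcon u hu.1 hu.2
  have h1 := LinearMap.finrank_range_add_finrank_ker (φ.prod ψ)
  have h2 := Submodule.finrank_mono hle
  have h3 := Submodule.finrank_le (LinearMap.range (φ.prod ψ))
  have h4 : Module.finrank ℝ (ℝ × ℝ) = 2 := by simp
  omega

theorem exists_mem_ker_notMem {V : Type*} [AddCommGroup V] [Module ℝ V]
    [FiniteDimensional ℝ V] (φ : V →ₗ[ℝ] ℝ) (W : Submodule ℝ V)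
    (hW : Module.finrank ℝ W + 1 < Module.finrank ℝ V) : ∃ u, φ u = 0 ∧ u ∉ W := by
  by_contra! hcon
  have hle : LinearMap.ker φ ≤ W := fun u hu => hcon u hu
  have h1 := LinearMap.finrank_range_add_finrank_ker φ
  have h2 := Submodule.finrank_mono hle
  have h3 := Submodule.finrank_le (LinearMap.range φ)
  have h4 : Module.finrank ℝ ℝ = 1 := by simp
  omega

/-- If the null cone of a bilinear form whose kernel is the line through `y` is, near one of its
points, covered by two hyperplanes, then one of their equations is trivial. -/
theorem eq_zero_or_eq_zero_of_mul_eq_zero_on_null {V : Type*} [NormedAddCommGroup V]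
    [NormedSpace ℝ V] [FiniteDimensional ℝ V] (b : V →ₗ[ℝ] V →ₗ[ℝ] ℝ)
    (hb : ∀ u w, b u w = b w u) (y : V) (hker : ∀ u, b u = 0 → ∃ a : ℝ, u = a • y)
    (hdim : 4 ≤ Module.finrank ℝ V) {A : V} (hA : b A A = 0)
    (hA0 : b A ≠ 0) (l m : V →ₗ[ℝ] ℝ) (h : ∀ᶠ v in 𝓝 A, b v v = 0 → l v * m v = 0) :
    l = 0 ∨ m = 0 := by
  have hspan (u : V) : Module.finrank ℝ (Submodule.span ℝ {u}) ≤ 1 := by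
    simpa using finrank_span_le_card (R := ℝ) ({u} : Set V)
  -- Otherwise `b` vanishes on the polar hyperplane of `A`. That hyperplane has dimension at least
  -- 3, hence contains some `u` outside the span of `A` and `y`; but `u` is then orthogonal to `ker
  -- (b A)`, so it differs from a multiple of `A` by a kernel vector, a contradiction.
  obtain ⟨w, hAw, hw⟩ : ∃ w, b A w = 0 ∧ b w w ≠ 0 := by
    by_contra! hcon
    obtain ⟨e, he⟩ : ∃ e, b A e ≠ 0 := by
      by_contra! h0
      exact hA0 (LinearMap.ext h0)
    have hAy : Module.finrank ℝ (Submodule.span ℝ {A, y}) ≤ 2 := by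
      classical
      have := finrank_span_finset_le_card (R := ℝ) ({A, y} : Finset V)
      rw [Finset.coe_pair] at this
      exact this.trans Finset.card_le_two
    obtain ⟨u, hu, hu'⟩ := exists_mem_ker_notMem (b A) (Submodule.span ℝ {A, y}) (by omega)
    have hpol : ∀ w, b A w = 0 → b u w = 0 := by
      intro w hw
      have h1 := hcon (u + w) (by simp [hu, hw])
      have h2 := hcon u hu
      have h3 := hcon w hw
      simp only [map_add, LinearMap.add_apply] at h1
      rw [hb w u] at h1
      linarith
    obtain ⟨a, ha⟩ := hker (u - (b u e / b A e) • A) (by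
      ext w
      have h1 := hpol (w - (b A w / b A e) • e) (by simp [he])
      simp only [map_sub, map_smul, smul_eq_mul] at h1
      simp only [map_sub, map_smul, LinearMap.sub_apply, LinearMap.smul_apply, smul_eq_mul,
        LinearMap.zero_apply]
      rw [← h1]; ring)
    apply hu'
    rw [Submodule.mem_span_pair]
    exact ⟨b u e / b A e, a, by rw [← ha]; abel⟩
  -- Up to scale, `p u` is the second intersection of the null cone with the line through `A` in the
  -- direction `u`: a quadratic parametrization of the cone. Since `p w = b w w • A`, the rescaled
  -- `p` sends a neighbourhood of `w` to null vectors near `A`.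
  set p : V → V := fun u => b u u • A - (2 * b A u) • u with hp
  have hbc : Continuous fun u => b u u := by
    have h1 : Continuous fun u => LinearMap.toContinuousLinearMap (b u) := by
      exact (LinearMap.continuous_of_finiteDimensional
        ((LinearMap.toContinuousLinearMap (E := V) (F' := ℝ) (𝕜 := ℝ)).toLinearMap ∘ₗ b))
    exact h1.clm_apply continuous_id
  have hbA : Continuous fun u => b A u := LinearMap.continuous_of_finiteDimensional (b A)
  have hpc : Continuous p :=
    (hbc.smul continuous_const).sub ((continuous_const.mul hbA).smul continuous_id)
  have hpn (u) : b (p u) (p u) = 0 := by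
    simp only [hp, map_sub, map_smul, LinearMap.sub_apply, LinearMap.smul_apply, smul_eq_mul, hA,
      hb u A]
    ring
  have hpq (l : V →ₗ[ℝ] ℝ) (x h : V) :
      ∃ β : ℝ, ∀ t : ℝ, l (p (x + t • h)) = l (p x) + β * t + l (p h) * t ^ 2 := by
    refine ⟨2 * b x h * l A - 2 * b A x * l h - 2 * b A h * l x, fun t => ?_⟩
    simp only [hp, map_sub, map_smul, map_add, LinearMap.add_apply, LinearMap.smul_apply,
      smul_eq_mul, hb h x]
    ring
  have hev : ∀ᶠ u in 𝓝 w, l (p u) * m (p u) = 0 := by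
    have hT : Tendsto (fun u => (b w w)⁻¹ • p u) (𝓝 w) (𝓝 A) := by
      have : Continuous fun u => (b w w)⁻¹ • p u := by fun_prop
      have h2 := this.tendsto w
      simpa [hp, hAw, smul_smul, hw] using h2
    filter_upwards [hT.eventually h] with u hu
    have := hu (by simp [hpn])
    simp only [map_smul, smul_eq_mul] at this
    have h2 : ((b w w)⁻¹ * (b w w)⁻¹) * (l (p u) * m (p u)) = 0 := by linarith
    have h3 : (b w w)⁻¹ ≠ 0 := inv_ne_zero hw
    simpa [h3] using h2
  -- If `l A = 0`, the product of the linear forms `b A` and `l` is zero. If `l A ≠ 0`, polarizing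
  -- at a `u` killed by both gives `b u = 0`, although `u` can be chosen off the kernel line.
  have key (l : V →ₗ[ℝ] ℝ) (hl : ∀ u, l (p u) = 0) : l = 0 := by
    simp only [hp, map_sub, map_smul, smul_eq_mul] at hl
    by_cases hlA : l A = 0
    · by_contra hl0
      obtain ⟨u, hu⟩ : ∃ u, l u ≠ 0 := by
        by_contra! h0
        exact hl0 (LinearMap.ext h0)
      obtain ⟨v, hv⟩ : ∃ v, b A v ≠ 0 := by
        by_contra! h0
        exact hA0 (LinearMap.ext h0)
      have h1 : ∀ u, b A u * l u = 0 := fun u => by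
        have := hl u
        rw [hlA] at this
        linarith
      have h2 : b A u = 0 := (mul_eq_zero.1 (h1 u)).resolve_right hu
      have h3 : l v = 0 := (mul_eq_zero.1 (h1 v)).resolve_left hv
      have h4 := h1 (u + v)
      simp only [map_add, h2, h3, zero_add, add_zero] at h4
      exact (mul_ne_zero hv hu) h4
    · exfalso
      have := hspan y
      obtain ⟨u, hu, hlu, huy⟩ := exists_mem_ker_inf_ker_notMem (b A) l (Submodule.span ℝ {y})
        (by omega)
      obtain ⟨a, ha⟩ := hker u (by
        ext w
        have h1 := hl (u + w)
        have h2 := hl u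
        have h3 := hl w
        simp only [map_add, LinearMap.add_apply, hu, hlu, hb w u] at h1 h2
        have : l A * b u w = 0 := by linarith
        simpa [hlA] using this)
      exact huy (ha ▸ Submodule.smul_mem _ _ (Submodule.mem_span_singleton_self y))
  have hlp : Continuous fun u => l (p u) :=
    (LinearMap.continuous_of_finiteDimensional l).comp hpc
  exact (quadratic_eq_zero_or_eq_zero (hpq l) (hpq m) hlp hev).imp (key l) (key m)

/-! ### Retractions onto regular zero loci, and calculus of the dot product. -/

/-- Near a regular point, the zero locus of a `C¹` function is a `C¹` retract. -/
theorem exists_retraction {E : Type*} [NormedAddCommGroup E] [NormedSpace ℝ E] [CompleteSpace E]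
    {F : E → ℝ} {x : E} (hF : ContDiffAt ℝ 1 F x) (hx : F x = 0) (hF' : fderiv ℝ F x ≠ 0) :
    ∃ r : E → E, ContDiffAt ℝ 1 r x ∧ r x = x ∧ (∀ᶠ z in 𝓝 x, F (r z) = 0) ∧
      ∃ C : ℝ, ∀ᶠ z in 𝓝 x, ‖z - r z‖ ≤ C * |F z| := by
  obtain ⟨u, hu⟩ : ∃ u, fderiv ℝ F x u = 1 := by
    obtain ⟨v, hv⟩ : ∃ v, fderiv ℝ F x v ≠ 0 := by
      by_contra! h0
      exact hF' (ContinuousLinearMap.ext h0)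
    exact ⟨(fderiv ℝ F x v)⁻¹ • v, by simp [hv]⟩
  set L := fderiv ℝ F x with hL
  -- A chart that straightens `F`: its derivative at `x` is the identity, and `L (Ψ z - x) = F z`.
  set Ψ : E → E := fun z => z + (F z - L (z - x)) • u with hΨ
  have hΨc : ContDiffAt ℝ 1 Ψ x := by
    have : ContDiffAt ℝ 1 (fun z => L (z - x)) x := by fun_prop
    exact contDiffAt_id.add ((hF.sub this).smul contDiffAt_const)
  have hΨx : Ψ x = x := by simp [hΨ, hx]
  have hΨd : HasFDerivAt Ψ ((ContinuousLinearEquiv.refl ℝ E : E ≃L[ℝ] E) : E →L[ℝ] E) x := by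
    have h1 : HasFDerivAt F L x := (hF.differentiableAt (by norm_num)).hasFDerivAt
    have h2 : HasFDerivAt (fun z => L (z - x)) L x :=
      L.hasFDerivAt.comp x ((hasFDerivAt_id x).sub_const x)
    have h3 := (hasFDerivAt_id (𝕜 := ℝ) x).add ((h1.sub h2).smul_const u)
    rw [sub_self] at h3
    convert h3 using 1
    · ext v; simp [hΨ]
    · ext v; simp
  have hΨL (z) : L (Ψ z - x) = F z := by
    simp only [hΨ, map_sub, map_add, map_smul, hu, smul_eq_mul]; ring
  set Φ : E → E := ⇑(hΨc.toOpenPartialHomeomorph Ψ hΨd (by norm_num)).symm with hΦ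
  have hΦc : ContDiffAt ℝ 1 Φ x := by
    have := hΨc.to_localInverse hΨd (by norm_num)
    rw [hΨx] at this
    exact this
  have hΦx : Φ x = x := by
    have := hΨc.localInverse_apply_image hΨd (by norm_num)
    rwa [hΨx] at this
  have hr : ∀ᶠ z in 𝓝 x, Ψ (Φ z) = z := by
    have hm : x ∈ (hΨc.toOpenPartialHomeomorph Ψ hΨd (by norm_num)).target := by
      simpa [hΨx] using hΨc.image_mem_toOpenPartialHomeomorph_target hΨd (by norm_num)
    filter_upwards [(hΨc.toOpenPartialHomeomorph Ψ hΨd (by norm_num)).open_target.mem_nhds hm]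
      with z hz
    exact (hΨc.toOpenPartialHomeomorph Ψ hΨd (by norm_num)).right_inv hz
  have hl : ∀ᶠ z in 𝓝 x, Φ (Ψ z) = z := by
    have hm := hΨc.mem_toOpenPartialHomeomorph_source hΨd (by norm_num)
    filter_upwards [(hΨc.toOpenPartialHomeomorph Ψ hΨd (by norm_num)).open_source.mem_nhds hm]
      with z hz
    exact (hΨc.toOpenPartialHomeomorph Ψ hΨd (by norm_num)).left_inv hz
  -- Removing the `F`-component along `u` in the chart; the retraction is `Φ ∘ q`.
  set q : E → E := fun z => Ψ z - F z • u with hq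
  have hqc : ContDiffAt ℝ 1 q x := hΨc.sub (hF.smul contDiffAt_const)
  have hqx : q x = x := by simp [hq, hΨx, hx]
  have hqT : Tendsto q (𝓝 x) (𝓝 x) := by
    have := hqc.continuousAt.tendsto
    rwa [hqx] at this
  have hΨT : Tendsto Ψ (𝓝 x) (𝓝 x) := by
    have := hΨc.continuousAt.tendsto
    rwa [hΨx] at this
  refine ⟨fun z => Φ (q z), ?_, by simp [hqx, hΦx], ?_, ?_⟩
  · exact ContDiffAt.comp x (by rwa [hqx]) hqc
  · filter_upwards [hqT.eventually hr] with z hz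
    rw [← hΨL, hz]
    have := hΨL z
    simp only [hq, map_sub, map_smul, hu, smul_eq_mul] at this ⊢
    linarith
  -- `z = Φ (Ψ z)` and `r z = Φ (q z)`, where `Ψ z` and `q z` differ by `F z • u`; a Lipschitz
  -- constant of `Φ` gives the bound.
  · obtain ⟨K, t, ht, hK⟩ := hΦc.exists_lipschitzOnWith
    refine ⟨K * ‖u‖, ?_⟩
    filter_upwards [hl, hΨT ht, hqT ht] with z h1 h2 h3
    have := hK.dist_le_mul _ h2 _ h3
    rw [dist_eq_norm, dist_eq_norm, h1] at this
    refine this.trans (le_of_eq ?_)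
    simp only [hq, sub_sub_cancel, norm_smul, Real.norm_eq_abs]
    ring

/-- If the zero locus of `F` lies in that of `g` near a common regular point at which the
differentials are proportional, then the two loci coincide there. -/
theorem eventually_eq_zero_of_regular {E : Type*} [NormedAddCommGroup E] [NormedSpace ℝ E]
    {F g : E → ℝ} {x : E} (hF : ContDiffAt ℝ 1 F x)
    (hg : ContDiffAt ℝ 1 g x) {κ : ℝ} (hκ : κ ≠ 0) (hd : fderiv ℝ g x = κ • fderiv ℝ F x)
    {r : E → E} (hr : ContinuousAt r x) (hrx : r x = x) {C : ℝ}
    (hC : ∀ᶠ z in 𝓝 x, ‖z - r z‖ ≤ C * |F z|)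
    (hrF : ∀ᶠ z in 𝓝 x, F (r z) = 0)
    (hrg : ∀ᶠ z in 𝓝 x, g (r z) = 0) :
    ∀ᶠ z in 𝓝 x, g z = 0 → F z = 0 := by
  have h1 : HasStrictFDerivAt (fun z => g z - κ * F z) (0 : E →L[ℝ] ℝ) x := by
    have h2 := (hg.hasStrictFDerivAt (by norm_num)).sub
      ((hF.hasStrictFDerivAt (by norm_num)).const_mul κ)
    rwa [hd, sub_self] at h2
  have hT : Tendsto (fun z => (z, r z)) (𝓝 x) (𝓝 (x, x)) := by
    have : ContinuousAt (fun z => (z, r z)) x := continuousAt_id.prodMk hr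
    simpa [ContinuousAt, hrx] using this
  -- The increment of `g - κ F` between `r z` and `z` is `o(‖z - r z‖)`, hence `o(|F z|)`. The
  -- constant is chosen so that `g z = 0` yields `|κ| |F z| ≤ |κ| |F z| / 2`.
  have h2 := hT.eventually (h1.isLittleO.def (c := |κ| / (2 * (|C| + 1))) (by positivity))
  filter_upwards [h2, hC, hrF, hrg] with z h3 h4 h5 h6 h7
  simp only [h7, h5, h6, _root_.zero_apply] at h3
  simp only [zero_sub, mul_zero, sub_zero, sub_self, norm_neg, Real.norm_eq_abs, abs_mul] at h3
  have h8 : |κ| * |F z| ≤ |κ| / (2 * (|C| + 1)) * ((|C| + 1) * |F z|) := by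
    refine h3.trans ?_
    gcongr
    refine h4.trans ?_
    gcongr
    linarith [le_abs_self C]
  have h9 : |κ| / (2 * (|C| + 1)) * ((|C| + 1) * |F z|) = |κ| * |F z| / 2 := by
    have : |C| + 1 ≠ 0 := by positivity
    field_simp
  rw [h9] at h8
  have h10 : |κ| * |F z| = 0 := le_antisymm (by linarith) (by positivity)
  have : |κ| ≠ 0 := abs_ne_zero.2 hκ
  simpa [hκ] using h10

theorem HasDerivAt.dotProduct {n : Type*} [Fintype n] {u v : ℝ → n → ℝ} {u' v' : n → ℝ} {t : ℝ}
    (hu : HasDerivAt u u' t) (hv : HasDerivAt v v' t) :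
    HasDerivAt (fun s => u s ⬝ᵥ v s) (u' ⬝ᵥ v t + u t ⬝ᵥ v') t := by
  simp only [_root_.dotProduct, ← Finset.sum_add_distrib]
  exact HasDerivAt.fun_sum fun i _ => (hasDerivAt_pi.1 hu i).mul (hasDerivAt_pi.1 hv i)

theorem HasDerivAt.const_dotProduct {n : Type*} [Fintype n] {v : ℝ → n → ℝ} {v' : n → ℝ} {t : ℝ}
    (k : n → ℝ) (hv : HasDerivAt v v' t) :
    HasDerivAt (fun s => k ⬝ᵥ v s) (k ⬝ᵥ v') t := by
  simpa using (hasDerivAt_const t k).dotProduct hv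

theorem HasDerivAt.const_mulVec {m n : Type*} [Fintype n] [Fintype m] (A : Matrix m n ℝ)
    {v : ℝ → n → ℝ} {v' : n → ℝ} {t : ℝ} (hv : HasDerivAt v v' t) :
    HasDerivAt (fun s => A *ᵥ v s) (A *ᵥ v') t :=
  hasDerivAt_pi.2 fun i => hv.const_dotProduct (A i)

theorem Filter.Tendsto.dotProduct {α n : Type*} [Fintype n] {l : Filter α} {u v : α → n → ℝ}
    {a b : n → ℝ} (hu : Tendsto u l (𝓝 a)) (hv : Tendsto v l (𝓝 b)) :
    Tendsto (fun s => u s ⬝ᵥ v s) l (𝓝 (a ⬝ᵥ b)) := by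
  have : Continuous fun p : (n → ℝ) × (n → ℝ) => p.1 ⬝ᵥ p.2 :=
    continuous_fst.dotProduct continuous_snd
  exact (this.tendsto (a, b)).comp (hu.prodMk_nhds hv)

theorem DifferentiableAt.hasDerivAt_line {E F : Type*} [NormedAddCommGroup E] [NormedSpace ℝ E]
    [NormedAddCommGroup F] [NormedSpace ℝ F] {f : E → F} {x : E} (hf : DifferentiableAt ℝ f x)
    (h : E) : HasDerivAt (fun s : ℝ => f (x + s • h)) (fderiv ℝ f x h) 0 := by
  have h1 : HasDerivAt (fun s : ℝ => x + s • h) h 0 := by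
    simpa using ((hasDerivAt_id (0 : ℝ)).smul_const h).const_add x
  have h2 : HasFDerivAt f (fderiv ℝ f x) (x + (0 : ℝ) • h) := by simpa using hf.hasFDerivAt
  exact h2.comp_hasDerivAt 0 h1

theorem tendsto_line {E : Type*} [NormedAddCommGroup E] [NormedSpace ℝ E] (x h : E) :
    Tendsto (fun s : ℝ => x + s • h) (𝓝 0) (𝓝 x) := by
  have : Continuous (fun t : ℝ => x + t • h) := by fun_prop
  simpa using this.tendsto 0

theorem Matrix.IsSymm.mulVec_dotProduct_comm {n : Type*} [Fintype n] {A : Matrix n n ℝ}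
    (hA : A.IsSymm) (u v : n → ℝ) : (A *ᵥ u) ⬝ᵥ v = u ⬝ᵥ (A *ᵥ v) := by
  rw [dotProduct_mulVec, ← mulVec_transpose, hA.eq]

theorem exists_eq_smul_of_forall_dotProduct {n : Type*} [Fintype n] {k ν : n → ℝ} (hν : ν ≠ 0)
    (h : ∀ u, ν ⬝ᵥ u = 0 → k ⬝ᵥ u = 0) : ∃ a : ℝ, k = a • ν := by
  have hνν : ν ⬝ᵥ ν ≠ 0 := by simpa using hν
  refine ⟨(ν ⬝ᵥ k) / (ν ⬝ᵥ ν), ?_⟩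
  set u := k - ((ν ⬝ᵥ k) / (ν ⬝ᵥ ν)) • ν with hu
  have h1 : ν ⬝ᵥ u = 0 := by
    simp only [hu, dotProduct_sub, dotProduct_smul, smul_eq_mul]
    field_simp; ring
  have h2 : u ⬝ᵥ u = 0 := by
    nth_rewrite 1 [hu]
    rw [sub_dotProduct, smul_dotProduct, h1, h u h1]; simp
  exact sub_eq_zero.1 (dotProduct_self_eq_zero.1 h2)

/-- In finite dimension, a bilinear form that separates on the left separates on the right. -/
theorem separating_right_of_left {E : Type*} [AddCommGroup E] [Module ℝ E]
    [FiniteDimensional ℝ E] (b : E →ₗ[ℝ] E →ₗ[ℝ] ℝ) (T : Submodule ℝ E)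
    (h : ∀ v ∈ T, (∀ w ∈ T, b v w = 0) → v = 0) {w : E} (hw : w ∈ T)
    (hw0 : ∀ v ∈ T, b v w = 0) : w = 0 := by
  set L : T →ₗ[ℝ] Module.Dual ℝ T := (b.compl₁₂ T.subtype T.subtype) with hL
  have hinj : Function.Injective L := by
    rw [injective_iff_map_eq_zero]
    intro v hv
    have := h v v.2 fun w hw => by
      simpa [hL] using congrArg (fun f => f ⟨w, hw⟩) hv
    exact Subtype.ext this
  have hsurj : Function.Surjective L :=
    (LinearMap.injective_iff_surjective_of_finrank_eq_finrank
      (Subspace.dual_finrank_eq (K := ℝ) (V := T)).symm).1 hinj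
  have h0 : (⟨w, hw⟩ : T) = 0 := by
    rw [← Module.forall_dual_apply_eq_zero_iff ℝ]
    intro φ
    obtain ⟨v, rfl⟩ := hsurj φ
    simpa [hL] using hw0 v v.2
  exact congrArg Subtype.val h0

/-! ### The equation `R ν = l G ν + c y` along a hypersurface. -/

namespace SpaceForm

variable {d : ℕ} {S : Set (Ambient d)} {B : Ambient d}

theorem dotProduct_eq_zero_of_mem_tangentVectors {y k : Ambient d}
    (hk : ∀ᶠ x in 𝓝[S] y, k ⬝ᵥ x = 0) {w : Ambient d} (hw : w ∈ tangentVectors S y) :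
    k ⬝ᵥ w = 0 := by
  obtain ⟨γ, hγ0, hγ, hγS⟩ := hw
  have hT : Tendsto γ (𝓝 0) (𝓝[S] y) := by
    rw [tendsto_nhdsWithin_iff]
    exact ⟨by simpa [hγ0] using hγ.continuousAt.tendsto, hγS⟩
  have h0 : (fun s => k ⬝ᵥ γ s) =ᶠ[𝓝 0] fun _ => 0 := hT.eventually hk
  exact (hγ.const_dotProduct k).unique ((hasDerivAt_const 0 (0 : ℝ)).congr_of_eventuallyEq h0)

theorem fderiv_apply_mem_tangentVectors {r : Ambient d → Ambient d} {z : Ambient d}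
    (hr : DifferentiableAt ℝ r z) (hrS : ∀ᶠ w in 𝓝 z, r w ∈ S) (h : Ambient d) :
    fderiv ℝ r z h ∈ tangentVectors S (r z) :=
  ⟨fun s => r (z + s • h), by simp, hr.hasDerivAt_line h, (tendsto_line z h).eventually hrS⟩

theorem fderiv_apply_of_mem_tangentVectors {r : Ambient d → Ambient d} {z : Ambient d}
    (hr : DifferentiableAt ℝ r z) (hrr : ∀ᶠ w in 𝓝[S] z, r w = w) {v : Ambient d}
    (hv : v ∈ tangentVectors S z) : fderiv ℝ r z v = v := by
  obtain ⟨γ, hγ0, hγ, hγS⟩ := hv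
  have hT : Tendsto γ (𝓝 0) (𝓝[S] z) := by
    rw [tendsto_nhdsWithin_iff]
    exact ⟨by simpa [hγ0] using hγ.continuousAt.tendsto, hγS⟩
  have h1 : HasFDerivAt r (fderiv ℝ r z) (γ 0) := by rw [hγ0]; exact hr.hasFDerivAt
  have h2 := h1.comp_hasDerivAt 0 hγ
  exact h2.unique (hγ.congr_of_eventuallyEq (hT.eventually hrr))

/-- Let `S` be a `C¹` retract with conormal field `ν` such that, at each point `y` of `S` near `B`,
`R ν` lies in the span of `G ν` and `y`. Then the coefficient of `G ν` is constant. -/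
theorem exists_constant_coefficient
    {R G : Matrix (Fin (d + 1)) (Fin (d + 1)) ℝ} (hR : R.IsSymm) (hG : G.IsSymm)
    {n r : Ambient d → Ambient d} (hn : ContDiffAt ℝ 1 n B) (hr : ContDiffAt ℝ 1 r B)
    (hy : ∀ᶠ z in 𝓝 B, n z ⬝ᵥ r z = 0)
    (hn1 : ∀ᶠ z in 𝓝 B, n z ⬝ᵥ (G *ᵥ n z) = 1)
    (hp : ∀ᶠ z in 𝓝 B, ∃ l c : ℝ, R *ᵥ n z = l • (G *ᵥ n z) + c • r z)
    (ht : ∀ᶠ z in 𝓝 B, ∀ h, n z ⬝ᵥ fderiv ℝ r z h = 0) :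
    ∃ t : ℝ, ∀ᶠ z in 𝓝 B, ∃ c : ℝ, (R - t • G) *ᵥ n z = c • r z := by
  have hall := (hn.eventually (by norm_num)).and ((hr.eventually (by norm_num)).and
    (hy.eventually_nhds.and (hn1.eventually_nhds.and (hp.and ht))))
  obtain ⟨ε, hε, hball⟩ := Metric.eventually_nhds_iff_ball.1 hall
  -- The derivative is `2 n' · R n = 2 l (n' · G n) + 2 c (n' · r)`. The first term vanishes because
  -- `n · G n = 1`, the second because `n · r = 0` and `n · r' = 0`.
  have hder : ∀ z ∈ Metric.ball B ε, ∀ h, HasDerivAt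
      (fun s : ℝ => n (z + s • h) ⬝ᵥ (R *ᵥ n (z + s • h))) 0 0 := by
    intro z hz h
    obtain ⟨h1, h2, h3, h4, ⟨l, c, h5⟩, h6⟩ := hball z hz
    have dn := (h1.differentiableAt (by norm_num)).hasDerivAt_line h
    have dr := (h2.differentiableAt (by norm_num)).hasDerivAt_line h
    have e1 := (dn.dotProduct dr).unique ((hasDerivAt_const 0 (0 : ℝ)).congr_of_eventuallyEq
      ((tendsto_line z h).eventually h3))
    have e2 := (dn.dotProduct (dn.const_mulVec G)).unique
      ((hasDerivAt_const 0 (1 : ℝ)).congr_of_eventuallyEq ((tendsto_line z h).eventually h4))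
    convert dn.dotProduct (dn.const_mulVec R) using 1
    simp only [zero_smul, add_zero] at e1 e2 ⊢
    rw [h6 h, add_zero] at e1
    rw [← hG.mulVec_dotProduct_comm (n z), dotProduct_comm (G *ᵥ n z)] at e2
    rw [← hR.mulVec_dotProduct_comm (n z), dotProduct_comm (R *ᵥ n z), h5]
    simp only [dotProduct_add, dotProduct_smul, e1, smul_eq_mul]
    linear_combination -l * e2
  have hconst : ∀ z ∈ Metric.ball B ε, n z ⬝ᵥ (R *ᵥ n z) = n B ⬝ᵥ (R *ᵥ n B) := by
    intro z hz
    set g : ℝ → ℝ := fun s => n (B + s • (z - B)) ⬝ᵥ (R *ᵥ n (B + s • (z - B))) with hg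
    have hmem : ∀ s ∈ Set.Icc (0 : ℝ) 1, B + s • (z - B) ∈ Metric.ball B ε := by
      intro s hs
      exact (convex_ball B ε).add_smul_sub_mem (Metric.mem_ball_self hε) hz hs
    have hgd : ∀ s ∈ Set.Icc (0 : ℝ) 1, HasDerivAt g 0 s := by
      intro s hs
      have h1 := hder _ (hmem s hs) (z - B)
      have h2 : HasDerivAt (fun s' : ℝ => s' - s) 1 s := (hasDerivAt_id s).sub_const s
      have h3 := HasDerivAt.scomp_of_eq (h := fun s' : ℝ => s' - s) s h1 h2 (by simp)
      rw [smul_zero] at h3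
      refine h3.congr_of_eventuallyEq (Eventually.of_forall fun s' => ?_)
      have : B + s • (z - B) + (s' - s) • (z - B) = B + s' • (z - B) := by
        rw [add_assoc, ← add_smul]; simp
      simp only [hg, Function.comp, this]
    have := constant_of_has_deriv_right_zero (f := g) (a := 0) (b := 1)
      (fun s hs => (hgd s hs).continuousAt.continuousWithinAt)
      (fun s hs => (hgd s ⟨hs.1, hs.2.le⟩).hasDerivWithinAt) 1 (by simp)
    simpa [hg] using this
  refine ⟨n B ⬝ᵥ (R *ᵥ n B), ?_⟩
  filter_upwards [Metric.ball_mem_nhds B hε, hp, hy, hn1] with z hz h1 h2 h3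
  obtain ⟨l, c, h1⟩ := h1
  refine ⟨c, ?_⟩
  have h4 := hconst z hz
  rw [h1, dotProduct_add, dotProduct_smul, dotProduct_smul, h2, h3] at h4
  simp only [smul_eq_mul, mul_one, mul_zero, add_zero] at h4
  rw [← h4, sub_mulVec, smul_mulVec, h1]
  simp

/-- A symmetric matrix `A` with non-trivial kernel that maps the conormals of a hypersurface `S` to
multiples of the base points maps them to zero. -/
theorem eventually_mulVec_conormal_eq_zero {A : Matrix (Fin (d + 1)) (Fin (d + 1)) ℝ}
    (hA : A.IsSymm) {ν : Ambient d → Ambient d} (hν : ContDiffAt ℝ 1 ν B)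
    (hν0 : ∀ᶠ y in 𝓝[S] B, ν y ≠ 0)
    (hc : ∀ᶠ y in 𝓝[S] B, ∃ c : ℝ, A *ᵥ ν y = c • y)
    (hT : ∀ᶠ y in 𝓝[S] B, ∀ u, ν y ⬝ᵥ u = 0 → ∃ a : ℝ, u - a • y ∈ tangentVectors S y)
    {k : Ambient d} (hk : k ≠ 0) (hAk : A *ᵥ k = 0) :
    ∀ᶠ y in 𝓝[S] B, A *ᵥ ν y = 0 := by
  have hνe : ∀ᶠ y in 𝓝[S] B, ContDiffAt ℝ 1 ν y :=
    (hν.eventually (by norm_num)).filter_mono nhdsWithin_le_nhds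
  filter_upwards [eventually_eventually_nhdsWithin.2 hc, hνe, hν0, hT, self_mem_nhdsWithin]
    with y h1 h2 h3 h4 hyS
  by_contra hne
  have hcont : ContinuousAt (fun x => A *ᵥ ν x) y :=
    (Continuous.matrix_mulVec continuous_const continuous_id).continuousAt.comp h2.continuousAt
  -- Where `A ν ≠ 0` the factor `c` is non-zero, so `c (k · x) = A k · ν = 0` puts `S` into the
  -- hyperplane `k · x = 0`. Then `k` is itself a conormal, and `A k = 0` contradicts `A ν ≠ 0`.
  have h5 : ∀ᶠ x in 𝓝[S] y, k ⬝ᵥ x = 0 := by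
    filter_upwards [h1, (hcont.eventually_ne hne).filter_mono nhdsWithin_le_nhds]
      with x ⟨c, hx⟩ hx'
    have hcne : c ≠ 0 := by
      rintro rfl
      exact hx' (by simpa using hx)
    have h6 : k ⬝ᵥ (A *ᵥ ν x) = 0 := by
      rw [← hA.mulVec_dotProduct_comm, hAk, zero_dotProduct]
    rw [hx, dotProduct_smul] at h6
    simpa [hcne] using h6
  have hky : k ⬝ᵥ y = 0 := h5.self_of_nhdsWithin hyS
  obtain ⟨a, ha⟩ := exists_eq_smul_of_forall_dotProduct (k := k) h3 (by
    intro u hu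
    obtain ⟨a, ha⟩ := h4 u hu
    have h7 := dotProduct_eq_zero_of_mem_tangentVectors h5 ha
    rw [dotProduct_sub, dotProduct_smul, hky] at h7
    simpa using h7)
  have ha0 : a ≠ 0 := by
    rintro rfl
    exact hk (by simpa using ha)
  rw [ha, mulVec_smul] at hAk
  exact hne ((smul_eq_zero.1 hAk).resolve_left ha0)

/-- If the conormal `ν` of a hypersurface `S` satisfies `R ν = l G ν + c y` at its points `y`,
where `R` is not a multiple of `G`, and `S` has a non-degenerate second fundamental form at `B`, then
`l` is a constant `t` for which `R - t G` is invertible. -/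
theorem exists_pencil_parameter
    {R G : Matrix (Fin (d + 1)) (Fin (d + 1)) ℝ} (hR : R.IsSymm) (hG : G.IsSymm)
    (hRG : ∀ t : ℝ, R ≠ t • G)
    {ν r : Ambient d → Ambient d} (hν : ContDiffAt ℝ 1 ν B)
    (hr : ContDiffAt ℝ 1 r B) (hrB : r B = B) (hBS : B ∈ S) (hB : B ≠ 0)
    (hrS : ∀ᶠ z in 𝓝 B, r z ∈ S) (hrr : ∀ᶠ z in 𝓝[S] B, r z = z)
    (hy : ∀ᶠ y in 𝓝[S] B, ν y ⬝ᵥ y = 0)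
    (hn : ∀ᶠ y in 𝓝[S] B, ν y ⬝ᵥ (G *ᵥ ν y) = 1)
    (hp : ∀ᶠ y in 𝓝[S] B, ∃ l c : ℝ, R *ᵥ ν y = l • (G *ᵥ ν y) + c • y)
    (ht : ∀ᶠ y in 𝓝[S] B, ∀ w ∈ tangentVectors S y, ν y ⬝ᵥ w = 0)
    (hT : ∀ᶠ y in 𝓝[S] B, ∀ u, ν y ⬝ᵥ u = 0 → ∃ a : ℝ, u - a • y ∈ tangentVectors S y)
    (T : Submodule ℝ (Ambient d)) (hTS : (T : Set (Ambient d)) = tangentVectors S B)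
    (hT0 : T ≠ ⊥)
    (hII : ∀ v ∈ T, (∀ w ∈ T, fderiv ℝ ν B v ⬝ᵥ w = 0) → v = 0) :
    ∃ t : ℝ, IsUnit (R - t • G).det ∧
      ∀ᶠ y in 𝓝[S] B, ∃ c : ℝ, (R - t • G) *ᵥ ν y = c • y := by
  have hrT : Tendsto r (𝓝 B) (𝓝[S] B) := by
    rw [tendsto_nhdsWithin_iff]
    exact ⟨by simpa [hrB] using hr.continuousAt.tendsto, hrS⟩
  have hnc : ContDiffAt ℝ 1 (fun z => ν (r z)) B :=
    ContDiffAt.comp B (by rwa [hrB]) hr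
  have hnd : ∀ᶠ z in 𝓝 B, DifferentiableAt ℝ (fun z => ν (r z)) z :=
    (hnc.eventually (by norm_num)).mono fun z hz => hz.differentiableAt (by norm_num)
  have hrd : ∀ᶠ z in 𝓝 B, DifferentiableAt ℝ r z :=
    (hr.eventually (by norm_num)).mono fun z hz => hz.differentiableAt (by norm_num)
  have hrt : ∀ᶠ z in 𝓝 B, ∀ h, ν (r z) ⬝ᵥ fderiv ℝ r z h = 0 := by
    filter_upwards [hrd, hrS.eventually_nhds, hrT.eventually ht] with z h1 h2 h3 h
    exact h3 _ (fderiv_apply_mem_tangentVectors h1 h2 h)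
  obtain ⟨t, ht'⟩ := exists_constant_coefficient hR hG hnc hr (hrT.eventually hy)
    (hrT.eventually hn) (hrT.eventually hp) hrt
  have hc : ∀ᶠ y in 𝓝[S] B, ∃ c : ℝ, (R - t • G) *ᵥ ν y = c • y := by
    filter_upwards [ht'.filter_mono nhdsWithin_le_nhds, hrr] with y h1 h2
    rwa [h2] at h1
  refine ⟨t, ?_, hc⟩
  by_contra hdet
  set A := R - t • G with hAdef
  have hA : A.IsSymm := hR.sub (hG.smul t)
  obtain ⟨k, hk, hAk⟩ := Matrix.exists_mulVec_eq_zero_iff.2 (by simpa using hdet : A.det = 0)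
  have hν0 : ∀ᶠ y in 𝓝[S] B, ν y ≠ 0 := by
    filter_upwards [hn] with y h1 h2
    simp [h2] at h1
  have hAν := hrT.eventually (eventually_mulVec_conormal_eq_zero hA hν hν0 hc hT hk hAk)
  -- the derivative of the conormal field along the retraction
  have hDy : ∀ᶠ z in 𝓝 B, ∀ h, fderiv ℝ (fun z => ν (r z)) z h ⬝ᵥ r z = 0 := by
    filter_upwards [hnd, hrd, hrt, (hrT.eventually hy).eventually_nhds] with z h1 h2 h3 h4 h
    have e1 := ((h1.hasDerivAt_line h).dotProduct (h2.hasDerivAt_line h)).unique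
      ((hasDerivAt_const 0 (0 : ℝ)).congr_of_eventuallyEq ((tendsto_line z h).eventually h4))
    simpa [h3 h] using e1
  have hDA : ∀ h, A *ᵥ fderiv ℝ (fun z => ν (r z)) B h = 0 := by
    intro h
    exact ((hnd.self_of_nhds.hasDerivAt_line h).const_mulVec A).unique
      ((hasDerivAt_const 0 (0 : Ambient d)).congr_of_eventuallyEq
        ((tendsto_line B h).eventually hAν))
  have hDν : ∀ v ∈ T, fderiv ℝ (fun z => ν (r z)) B v = fderiv ℝ ν B v := by
    intro v hv
    have h1 : HasFDerivAt ν (fderiv ℝ ν B) (r B) := by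
      rw [hrB]; exact (hν.differentiableAt (by norm_num)).hasFDerivAt
    have h2 := h1.comp B hrd.self_of_nhds.hasFDerivAt
    have h3 : fderiv ℝ (fun z => ν (r z)) B = _ := h2.fderiv
    rw [h3, ContinuousLinearMap.comp_apply, fderiv_apply_of_mem_tangentVectors
      hrd.self_of_nhds hrr (by rw [← hTS]; exact hv)]
  have hII' : ∀ w ∈ T, (∀ v ∈ T, fderiv ℝ ν B v ⬝ᵥ w = 0) → w = 0 := by
    intro w hw hw0
    refine separating_right_of_left
      ((dotProductBilin ℝ ℝ (m := Fin (d + 1)) (A := ℝ)).comp (fderiv ℝ ν B).toLinearMap) T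
      ?_ hw ?_
    · intro v hv hvw
      exact hII v hv fun w hw => by simpa using hvw w hw
    · intro v hv
      simpa using hw0 v hv
  -- By symmetry of `A` and `A ν = 0`, the vector `A x` is tangent to `S` modulo `B`. It pairs to
  -- zero with the derivatives of `ν`, as `A` kills them, and so does `B`; non-degeneracy leaves
  -- only the multiple of `B`. So `A` has rank at most one.
  have hAB : ∀ x, ∃ a : ℝ, A *ᵥ x = a • B := by
    intro x
    have h0 : A *ᵥ ν B = 0 := by simpa [hrB] using hAν.self_of_nhds
    obtain ⟨a, ha⟩ := hT.self_of_nhdsWithin hBS (A *ᵥ x) (by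
      rw [← hA.mulVec_dotProduct_comm, h0, zero_dotProduct])
    refine ⟨a, sub_eq_zero.1 (hII' _ (by rw [← SetLike.mem_coe, hTS]; exact ha) ?_)⟩
    intro v hv
    rw [← hDν v hv, dotProduct_sub, dotProduct_smul, ← hA.mulVec_dotProduct_comm, hDA]
    have := hDy.self_of_nhds v
    rw [hrB] at this
    simp [this]
  obtain ⟨β, hβ⟩ := hAB B
  have hBB : B ⬝ᵥ B ≠ 0 := by simpa using hB
  have hβ0 : β ≠ 0 := by
    rintro rfl
    apply hRG t
    rw [← sub_eq_zero]
    apply Matrix.ext_of_mulVec_single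
    intro i
    obtain ⟨a, ha⟩ := hAB (Pi.single i 1)
    have h1 := hA.mulVec_dotProduct_comm (Pi.single i 1) B
    rw [hβ, ha, smul_dotProduct] at h1
    have : a = 0 := by simpa [hBB, hB] using h1
    rw [← hAdef, ha, this, zero_smul, zero_mulVec]
  have hBn : ∀ᶠ z in 𝓝 B, ν (r z) ⬝ᵥ B = 0 := by
    filter_upwards [hAν] with z hz
    have h1 := hA.mulVec_dotProduct_comm (ν (r z)) B
    rw [hz, hβ, dotProduct_smul] at h1
    simpa [hβ0] using h1.symm
  have hDB : ∀ᶠ z in 𝓝 B, ∀ h, fderiv ℝ (fun z => ν (r z)) z h ⬝ᵥ B = 0 := by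
    filter_upwards [hnd, hBn.eventually_nhds] with z h1 h2 h
    have e1 := ((h1.hasDerivAt_line h).dotProduct (hasDerivAt_const 0 B)).unique
      ((hasDerivAt_const 0 (0 : ℝ)).congr_of_eventuallyEq ((tendsto_line z h).eventually h2))
    simpa using e1
  obtain ⟨v, hv, hv0⟩ := (Submodule.ne_bot_iff T).1 hT0
  refine hv0 (hII' v hv fun h hh => ?_)
  rw [← hDν h hh]
  have hcont : ContinuousAt (fun z => fderiv ℝ (fun z => ν (r z)) z h) B :=
    (hnc.continuousAt_fderiv (by norm_num)).clm_apply continuousAt_const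
  -- The derivative of `ν` at `B + s v` is orthogonal to both `r (B + s v)` and `B`, hence to their
  -- difference quotient, which tends to `v`. In the limit the second fundamental form kills `v`.
  -- Only `C¹` regularity is needed.
  have hlim1 : Tendsto (fun s : ℝ => fderiv ℝ (fun z => ν (r z)) (B + s • v) h) (𝓝[≠] 0)
      (𝓝 (fderiv ℝ (fun z => ν (r z)) B h)) :=
    (hcont.tendsto.comp (tendsto_line B v)).mono_left nhdsWithin_le_nhds
  have hlim2 := hasDerivAt_iff_tendsto_slope_zero.1 (hrd.self_of_nhds.hasDerivAt_line v)
  rw [fderiv_apply_of_mem_tangentVectors hrd.self_of_nhds hrr (by rw [← hTS]; exact hv)] at hlim2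
  refine tendsto_nhds_unique (hlim1.dotProduct hlim2) ?_
  refine Tendsto.congr' ?_ tendsto_const_nhds
  filter_upwards [((tendsto_line B v).eventually (hDB.and hDy)).filter_mono nhdsWithin_le_nhds]
    with s hs
  simp [dotProduct_sub, hs.1 h, hs.2 h, hrB]

end SpaceForm

/-! ### Derivatives of quadratic forms and of retractions. -/

theorem ContDiffAt.dotProduct {E n : Type*} [Fintype n] [NormedAddCommGroup E] [NormedSpace ℝ E]
    {k : WithTop ℕ∞} {u v : E → n → ℝ} {x : E} (hu : ContDiffAt ℝ k u x)
    (hv : ContDiffAt ℝ k v x) : ContDiffAt ℝ k (fun z => u z ⬝ᵥ v z) x := by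
  simp only [_root_.dotProduct]
  exact ContDiffAt.sum fun i _ => (contDiffAt_pi.1 hu i).mul (contDiffAt_pi.1 hv i)

theorem ContDiffAt.const_mulVec {E m n : Type*} [Fintype m] [Fintype n] [NormedAddCommGroup E]
    [NormedSpace ℝ E] {k : WithTop ℕ∞} (A : Matrix m n ℝ) {v : E → n → ℝ} {x : E}
    (hv : ContDiffAt ℝ k v x) : ContDiffAt ℝ k (fun z => A *ᵥ v z) x :=
  contDiffAt_pi.2 fun _ => contDiffAt_const.dotProduct hv

theorem Matrix.IsSymm.hasDerivAt_mulVec_dotProduct_self {n : Type*} [Fintype n]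
    {A : Matrix n n ℝ} (hA : A.IsSymm) {v : ℝ → n → ℝ} {v' : n → ℝ} {t : ℝ}
    (hv : HasDerivAt v v' t) :
    HasDerivAt (fun s => (A *ᵥ v s) ⬝ᵥ v s) (2 * ((A *ᵥ v t) ⬝ᵥ v')) t := by
  convert (hv.const_mulVec A).dotProduct hv using 1
  rw [dotProduct_comm (A *ᵥ v'), ← hA.mulVec_dotProduct_comm]
  ring

theorem Matrix.IsSymm.fderiv_mulVec_dotProduct_self {n : Type*} [Fintype n]
    {A : Matrix n n ℝ} (hA : A.IsSymm) (x u : n → ℝ) :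
    fderiv ℝ (fun z => (A *ᵥ z) ⬝ᵥ z) x u = 2 * ((A *ᵥ x) ⬝ᵥ u) := by
  have h1 : ContDiffAt ℝ 1 (fun z => (A *ᵥ z) ⬝ᵥ z) x :=
    (contDiffAt_id.const_mulVec A).dotProduct contDiffAt_id
  have h2 := (h1.differentiableAt (by norm_num)).hasDerivAt_line u
  have h3 : HasDerivAt (fun s : ℝ => x + s • u) u 0 := by
    simpa using ((hasDerivAt_id (0 : ℝ)).smul_const u).const_add x
  simpa using h2.unique (hA.hasDerivAt_mulVec_dotProduct_self h3)

/-- Along a direction in `ker dF` the values of `F` are `o(s)`, so the bound on `z - r z` makes the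
derivative of `id - r` vanish there. -/
theorem fderiv_retraction_apply {E : Type*} [NormedAddCommGroup E] [NormedSpace ℝ E]
    {F : E → ℝ} {r : E → E} {x : E} (hF : DifferentiableAt ℝ F x) (hx : F x = 0)
    (hr : DifferentiableAt ℝ r x) (hrx : r x = x) {C : ℝ}
    (hC : ∀ᶠ z in 𝓝 x, ‖z - r z‖ ≤ C * |F z|) {v : E} (hv : fderiv ℝ F x v = 0) :
    fderiv ℝ r x v = v := by
  have h1 := hF.hasDerivAt_line v
  rw [hv, hasDerivAt_iff_isLittleO_nhds_zero] at h1
  simp only [zero_add, zero_smul, add_zero, hx, sub_zero, smul_zero] at h1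
  have h2 : HasDerivAt (fun s : ℝ => (x + s • v) - r (x + s • v)) 0 0 := by
    rw [hasDerivAt_iff_isLittleO_nhds_zero]
    simp only [zero_add, zero_smul, add_zero, hrx, sub_self, sub_zero, smul_zero]
    refine Asymptotics.IsBigO.trans_isLittleO ?_ h1
    refine Asymptotics.IsBigO.of_bound C ?_
    filter_upwards [(tendsto_line x v).eventually hC] with s hs
    simpa using hs
  have h3 : HasDerivAt (fun s : ℝ => x + s • v) v 0 := by
    simpa using ((hasDerivAt_id (0 : ℝ)).smul_const v).const_add x
  have := (h3.sub (hr.hasDerivAt_line v)).unique h2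
  exact (sub_eq_zero.1 this).symm

theorem exists_eq_smul_of_ker_le {E : Type*} [AddCommGroup E] [Module ℝ E] {φ ψ : E →ₗ[ℝ] ℝ}
    (h : ∀ u, φ u = 0 → ψ u = 0) (hψ : ψ ≠ 0) : ∃ κ : ℝ, κ ≠ 0 ∧ ψ = κ • φ := by
  obtain ⟨e, he⟩ : ∃ e, ψ e ≠ 0 := by
    by_contra! h0
    exact hψ (LinearMap.ext h0)
  have hφ : φ e ≠ 0 := fun h0 => he (h e h0)
  refine ⟨ψ e / φ e, div_ne_zero he hφ, LinearMap.ext fun u => ?_⟩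
  have := h (u - (φ u / φ e) • e) (by simp [hφ])
  simp only [map_sub, map_smul, smul_eq_mul] at this
  simp only [LinearMap.smul_apply, smul_eq_mul]
  rw [sub_eq_zero.1 this]
  ring

/-! ### Space forms: radial form, central projection, tangent vectors and conormals. -/

namespace SpaceForm

variable {d : ℕ} (M : SpaceForm)

theorem gramMatrix_isSymm (d : ℕ) : (M.gramMatrix d).IsSymm := by
  simp [gramMatrix, Matrix.IsSymm]

theorem metric_comm (v w : Ambient d) : M.metric v w = M.metric w v := by
  rw [metric, metric, ← (M.gramMatrix_isSymm d).mulVec_dotProduct_comm, dotProduct_comm]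

theorem metric_eq_mulVec_dotProduct (v w : Ambient d) :
    M.metric v w = (M.gramMatrix d *ᵥ v) ⬝ᵥ w :=
  ((M.gramMatrix_isSymm d).mulVec_dotProduct_comm v w).symm

theorem metric_smul_smul (a b : ℝ) (v w : Ambient d) :
    M.metric (a • v) (b • w) = a * b * M.metric v w := by
  simp only [metric, mulVec_smul, dotProduct_smul, smul_dotProduct, smul_eq_mul]; ring

/-- The linear form whose kernel is the tangent space of the space form at `y` and which takes the
value `1` at `y`. -/
noncomputable def radial (y : Ambient d) : Ambient d →ₗ[ℝ] ℝ where
  -- One formula for the three cases: it is `v 0` when `timeCoeff` is `0`, and `±⟨G y, v⟩` when it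
  -- is `±1`.
  toFun v := M.timeCoeff * M.metric y v + (1 - M.timeCoeff ^ 2) * v 0
  map_add' v w := by simp only [metric, mulVec_add, dotProduct_add, Pi.add_apply]; ring
  map_smul' a v := by
    simp only [metric, mulVec_smul, dotProduct_smul, Pi.smul_apply, smul_eq_mul, RingHom.id_apply]
    ring

theorem radial_apply (y v : Ambient d) :
    M.radial y v = M.timeCoeff * M.metric y v + (1 - M.timeCoeff ^ 2) * v 0 := rfl

theorem mem_tangentSpace_iff {y v : Ambient d} : v ∈ M.tangentSpace y ↔ M.radial y v = 0 := by
  cases M <;> simp [tangentSpace, radial_apply, timeCoeff]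

theorem radial_self {y : Ambient d} (hy : y ∈ M.carrier d) : M.radial y y = 1 := by
  cases M <;> simp only [carrier, Set.mem_ofPred_eq] at hy <;> simp [radial_apply, timeCoeff, hy]

theorem ne_zero_of_mem_carrier {y : Ambient d} (hy : y ∈ M.carrier d) : y ≠ 0 := by
  rintro rfl
  simpa using M.radial_self hy

/-- The homogeneous function of degree one that is equal to `1` on the space form. -/
noncomputable def radius (z : Ambient d) : ℝ :=
  match M with
  | euclidean => z 0
  | spherical => √(spherical.metric z z)
  | hyperbolic => √(-hyperbolic.metric z z)

/-- The central projection to the space form. -/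
noncomputable def proj (z : Ambient d) : Ambient d := (M.radius z)⁻¹ • z

theorem radius_of_mem {y : Ambient d} (hy : y ∈ M.carrier d) : M.radius y = 1 := by
  cases M <;> simp only [carrier, Set.mem_ofPred_eq] at hy <;> simp [radius, hy]

theorem proj_of_mem {y : Ambient d} (hy : y ∈ M.carrier d) : M.proj y = y := by
  simp [proj, M.radius_of_mem hy]

theorem contDiffAt_metric (k : WithTop ℕ∞) (z : Ambient d) :
    ContDiffAt ℝ k (fun z : Ambient d => M.metric z z) z :=
  contDiffAt_id.dotProduct (contDiffAt_id.const_mulVec _)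

theorem contDiffAt_radius {y : Ambient d} (hy : y ∈ M.carrier d) (k : WithTop ℕ∞) :
    ContDiffAt ℝ k (M.radius (d := d)) y := by
  cases M
  · exact contDiffAt_pi.1 contDiffAt_id 0
  · exact (spherical.contDiffAt_metric k y).sqrt (by
      have : spherical.metric y y = 1 := hy
      simp [this])
  · exact (hyperbolic.contDiffAt_metric k y).neg.sqrt (by
      have : hyperbolic.metric y y = -1 := hy.1
      simp [this])

theorem eventually_radius_ne_zero {y : Ambient d} (hy : y ∈ M.carrier d) :
    ∀ᶠ z in 𝓝 y, M.radius z ≠ 0 :=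
  (M.contDiffAt_radius hy 0).continuousAt.eventually_ne (by simp [M.radius_of_mem hy])

theorem contDiffAt_proj {y : Ambient d} (hy : y ∈ M.carrier d) (k : WithTop ℕ∞) :
    ContDiffAt ℝ k (M.proj (d := d)) y :=
  ((M.contDiffAt_radius hy k).inv (by simp [M.radius_of_mem hy])).smul contDiffAt_id

theorem tendsto_proj {y : Ambient d} (hy : y ∈ M.carrier d) : Tendsto M.proj (𝓝 y) (𝓝 y) := by
  have := (M.contDiffAt_proj hy 0).continuousAt.tendsto
  rwa [M.proj_of_mem hy] at this

theorem eventually_proj_mem {y : Ambient d} (hy : y ∈ M.carrier d) :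
    ∀ᶠ z in 𝓝 y, M.proj z ∈ M.carrier d := by
  cases M
  · filter_upwards [euclidean.eventually_radius_ne_zero hy] with z hz
    simp only [radius] at hz
    simp [carrier, proj, radius, hz]
  · filter_upwards [spherical.eventually_radius_ne_zero hy] with z hz
    simp only [carrier, Set.mem_ofPred_eq, proj, metric_smul_smul]
    simp only [radius] at hz ⊢
    have h0 : 0 < spherical.metric z z := by
      by_contra! h0
      exact hz (Real.sqrt_eq_zero_of_nonpos h0)
    rw [← mul_inv, Real.mul_self_sqrt h0.le, inv_mul_cancel₀ h0.ne']
  · have h0 : ∀ᶠ z in 𝓝 y, 0 < z 0 :=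
      (continuous_apply 0).continuousAt.eventually (lt_mem_nhds hy.2)
    filter_upwards [hyperbolic.eventually_radius_ne_zero hy, h0] with z hz hz0
    simp only [carrier, Set.mem_ofPred_eq, proj, metric_smul_smul, Pi.smul_apply, smul_eq_mul]
    simp only [radius] at hz ⊢
    have h0 : 0 < -hyperbolic.metric z z := by
      by_contra! h0
      exact hz (Real.sqrt_eq_zero_of_nonpos h0)
    have hs := Real.sqrt_pos.2 h0
    refine ⟨?_, by positivity⟩
    rw [← mul_inv, Real.mul_self_sqrt h0.le, inv_mul_eq_div, div_eq_iff h0.ne']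
    ring

theorem hasDerivAt_radius {γ : ℝ → Ambient d} {y v : Ambient d} (hy : y ∈ M.carrier d)
    (hγ0 : γ 0 = y) (hγ : HasDerivAt γ v 0) :
    HasDerivAt (fun s => M.radius (γ s)) (M.radial y v) 0 := by
  have h2 (M : SpaceForm) : HasDerivAt (fun s => M.metric (γ s) (γ s)) (2 * M.metric y v) 0 := by
    simp only [metric_eq_mulVec_dotProduct]
    simpa [hγ0] using (M.gramMatrix_isSymm d).hasDerivAt_mulVec_dotProduct_self hγ
  cases M
  · simpa [radius, radial_apply, timeCoeff] using hasDerivAt_pi.1 hγ 0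
  · have h1 : spherical.metric y y = 1 := hy
    refine ((h2 spherical).sqrt (by simp [hγ0, h1])).congr_deriv ?_
    simp [radial_apply, timeCoeff, hγ0, h1]
  · have h1 : hyperbolic.metric y y = -1 := hy.1
    refine ((h2 hyperbolic).fun_neg.sqrt (by simp [hγ0, h1])).congr_deriv ?_
    simp [radial_apply, timeCoeff, hγ0, h1, neg_div]

theorem hasDerivAt_proj {γ : ℝ → Ambient d} {y v : Ambient d} (hy : y ∈ M.carrier d)
    (hγ0 : γ 0 = y) (hγ : HasDerivAt γ v 0) :
    HasDerivAt (fun s => M.proj (γ s)) (v - M.radial y v • y) 0 := by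
  have h1 := ((M.hasDerivAt_radius hy hγ0 hγ).fun_inv (by simp [hγ0, M.radius_of_mem hy])).smul hγ
  refine h1.congr_deriv ?_
  rw [hγ0, M.radius_of_mem hy]
  simp [sub_eq_add_neg]

theorem radial_eq_zero_of_mem_tangentVectors {X : Set (Ambient d)} (hX : X ⊆ M.carrier d)
    {y v : Ambient d} (hy : y ∈ M.carrier d) (hv : v ∈ tangentVectors X y) :
    M.radial y v = 0 := by
  obtain ⟨γ, hγ0, hγ, hγX⟩ := hv
  refine (M.hasDerivAt_radius hy hγ0 hγ).unique ((hasDerivAt_const 0 (1 : ℝ)).congr_of_eventuallyEq ?_)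
  filter_upwards [hγX] with s hs
  exact M.radius_of_mem (hX hs)

theorem mem_tangentVectors_of_curve {X : Set (Ambient d)} {γ : ℝ → Ambient d} {y v : Ambient d}
    (hy : y ∈ M.carrier d) (hγ0 : γ 0 = y) (hγ : HasDerivAt γ v 0) (hv : M.radial y v = 0)
    (hX : ∀ᶠ s in 𝓝 0, M.proj (γ s) ∈ X) : v ∈ tangentVectors X y :=
  ⟨fun s => M.proj (γ s), by simp [hγ0, M.proj_of_mem hy], by
    simpa [hv] using M.hasDerivAt_proj hy hγ0 hγ, hX⟩

theorem mem_tangentVectors_of_line {X : Set (Ambient d)} {y v : Ambient d}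
    (hy : y ∈ M.carrier d) (hv : M.radial y v = 0)
    (hX : ∀ᶠ s in 𝓝 (0 : ℝ), M.proj (y + s • v) ∈ X) : v ∈ tangentVectors X y :=
  M.mem_tangentVectors_of_curve hy (γ := fun s : ℝ => y + s • v) (by simp) (by
    simpa using ((hasDerivAt_id (0 : ℝ)).smul_const v).const_add y) hv hX

/-- The curve is the line `y + s v`, pushed into the zero locus of `F` by the retraction and then to
the space form by `proj`; neither operation changes the velocity. -/
theorem mem_tangentVectors_of_fderiv {X : Set (Ambient d)} {F : Ambient d → ℝ} {y v : Ambient d}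
    (hy : y ∈ M.carrier d) (hF : ContDiffAt ℝ 1 F y) (hFy : F y = 0) (hF' : fderiv ℝ F y ≠ 0)
    (hX : ∀ᶠ z in 𝓝 y, F z = 0 → M.proj z ∈ X) (hv : M.radial y v = 0)
    (hFv : fderiv ℝ F y v = 0) : v ∈ tangentVectors X y := by
  obtain ⟨r, hr, hry, hrF, C, hC⟩ := exists_retraction hF hFy hF'
  have hrd := hr.differentiableAt (by norm_num)
  have h1 := hrd.hasDerivAt_line v
  rw [fderiv_retraction_apply (hF.differentiableAt (by norm_num)) hFy hrd hry hC hFv] at h1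
  refine M.mem_tangentVectors_of_curve hy (by simp [hry]) h1 hv ?_
  have hT : Tendsto r (𝓝 y) (𝓝 y) := by simpa [hry] using hr.continuousAt.tendsto
  exact (tendsto_line y v).eventually ((hT.eventually hX).mp (hrF.mono fun z h1 h2 => h2 h1))

theorem proj_mem_quadric_iff {Q : Matrix (Fin (d + 1)) (Fin (d + 1)) ℝ} {z : Ambient d}
    (hz : M.proj z ∈ M.carrier d) (hz0 : M.radius z ≠ 0) :
    M.proj z ∈ M.quadric Q ↔ (Q *ᵥ z) ⬝ᵥ z = 0 := by
  rw [quadric, Set.mem_ofPred_eq, and_iff_right hz]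
  simp [proj, mulVec_smul, hz0]

theorem eventually_proj_mem_quadric_iff (Q : Matrix (Fin (d + 1)) (Fin (d + 1)) ℝ) {y : Ambient d}
    (hy : y ∈ M.carrier d) :
    ∀ᶠ z in 𝓝 y, (M.proj z ∈ M.quadric Q ↔ (Q *ᵥ z) ⬝ᵥ z = 0) := by
  filter_upwards [M.eventually_proj_mem hy, M.eventually_radius_ne_zero hy] with z h1 h2
  exact M.proj_mem_quadric_iff h1 h2

theorem mem_tangentVectors_quadric {Q : Matrix (Fin (d + 1)) (Fin (d + 1)) ℝ} (hQ : Q.IsSymm)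
    {y v : Ambient d} (hy : y ∈ M.quadric Q) (hQy : Q *ᵥ y ≠ 0) (hv : M.radial y v = 0)
    (hQv : (Q *ᵥ y) ⬝ᵥ v = 0) : v ∈ tangentVectors (M.quadric Q) y := by
  refine M.mem_tangentVectors_of_fderiv (F := fun z => (Q *ᵥ z) ⬝ᵥ z) hy.1
    ((contDiffAt_id.const_mulVec Q).dotProduct contDiffAt_id) hy.2 ?_
    ((M.eventually_proj_mem_quadric_iff Q hy.1).mono fun z hz => hz.2) hv ?_
  · intro h0
    have := hQ.fderiv_mulVec_dotProduct_self y (Q *ᵥ y)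
    rw [h0] at this
    simp [hQy] at this
  · rw [hQ.fderiv_mulVec_dotProduct_self, hQv, mul_zero]

theorem mulVec_dotProduct_eq_zero_of_mem_tangentVectors
    {Q : Matrix (Fin (d + 1)) (Fin (d + 1)) ℝ} (hQ : Q.IsSymm)
    {y v : Ambient d} (hv : v ∈ tangentVectors (M.quadric Q) y) : (Q *ᵥ y) ⬝ᵥ v = 0 := by
  obtain ⟨γ, hγ0, hγ, hγX⟩ := hv
  have h1 := (hQ.hasDerivAt_mulVec_dotProduct_self hγ).unique
    ((hasDerivAt_const 0 (0 : ℝ)).congr_of_eventuallyEq (hγX.mono fun s hs => hs.2))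
  rw [hγ0] at h1
  linarith

/-- A hypersurface is locally the zero locus of a function that is constant along rays. -/
theorem IsC2HypersurfaceAt.exists_defining_function {M : SpaceForm} {X : Set (Ambient d)} {x : Ambient d}
    (h : M.IsC2HypersurfaceAt X x) (hx : x ∈ M.carrier d) :
    ∃ F : Ambient d → ℝ, ContDiffAt ℝ 1 F x ∧ fderiv ℝ F x ≠ 0 ∧
      (∀ᶠ z in 𝓝 x, (F z = 0 ↔ M.proj z ∈ X)) ∧
      ∀ᶠ y in 𝓝[M.carrier d] x, fderiv ℝ F y y = 0 := by
  obtain ⟨f, hf, ⟨v, hv, hfv⟩, hX⟩ := h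
  rw [mem_tangentSpace_iff] at hv
  have hf1 : ContDiffAt ℝ 1 f x := hf.of_le (by norm_num)
  have hFc : ∀ y ∈ M.carrier d, ContDiffAt ℝ 1 f y → ContDiffAt ℝ 1 (fun z => f (M.proj z)) y :=
    fun y hy hfy => ContDiffAt.comp y (by rwa [M.proj_of_mem hy]) (M.contDiffAt_proj hy 1)
  have hFd : ∀ y ∈ M.carrier d, ContDiffAt ℝ 1 f y → ∀ u,
      fderiv ℝ (fun z => f (M.proj z)) y u = fderiv ℝ f y (u - M.radial y u • y) := by
    intro y hy hfy u
    have h1 := ((hFc y hy hfy).differentiableAt (by norm_num)).hasDerivAt_line u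
    have h2 := M.hasDerivAt_proj hy (γ := fun s : ℝ => y + s • u) (v := u) (by simp) (by
      simpa using ((hasDerivAt_id (0 : ℝ)).smul_const u).const_add y)
    have h3 : HasFDerivAt f (fderiv ℝ f y) (M.proj (y + (0 : ℝ) • u)) := by
      simpa [M.proj_of_mem hy] using (hfy.differentiableAt (by norm_num)).hasFDerivAt
    exact h1.unique (h3.comp_hasDerivAt 0 h2)
  refine ⟨fun z => f (M.proj z), hFc x hx hf1, ?_, ?_, ?_⟩
  · intro h0
    apply hfv
    have := hFd x hx hf1 v
    rw [h0, hv] at this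
    simpa using this.symm
  · have hT : Tendsto M.proj (𝓝 x) (𝓝[M.carrier d] x) :=
      tendsto_nhdsWithin_iff.2 ⟨M.tendsto_proj hx, M.eventually_proj_mem hx⟩
    exact (hT.eventually hX).mono fun z hz => hz.symm
  · filter_upwards [(hf1.eventually (by norm_num)).filter_mono nhdsWithin_le_nhds,
      self_mem_nhdsWithin] with y hfy hy
    rw [hFd y hy hfy, M.radial_self hy]
    simp

/-- The covector in the ambient space that vanishes at `z` and is dual to the vector `N z`. -/
noncomputable def conormal (N : Ambient d → Ambient d) (z : Ambient d) : Ambient d :=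
  -- The correction is present only in the Euclidean case, where `G N` lacks the `x_0`-coordinate
  -- needed to annihilate the base point. In the other two cases tangency of `N` already gives this.
  M.gramMatrix d *ᵥ N z - (M.metric (N z) z * (1 - M.timeCoeff ^ 2)) • Pi.single 0 1

variable {M} {N : Ambient d → Ambient d}

theorem one_sub_sq_mul_eq_zero {y w : Ambient d} (hw : M.radial y w = 0) :
    (1 - M.timeCoeff ^ 2) * w 0 = 0 := by
  cases M <;> simp_all [radial_apply, timeCoeff]

theorem conormal_dotProduct {y w : Ambient d} (hw : M.radial y w = 0) (z : Ambient d) :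
    M.conormal N z ⬝ᵥ w = M.metric (N z) w := by
  rw [conormal, sub_dotProduct, smul_dotProduct, single_one_dotProduct, smul_eq_mul, mul_assoc,
    one_sub_sq_mul_eq_zero hw, M.metric_eq_mulVec_dotProduct (N z) w, mul_zero, sub_zero]

theorem conormal_dotProduct_self {y : Ambient d} (hy : y ∈ M.carrier d)
    (hN : M.radial y (N y) = 0) : M.conormal N y ⬝ᵥ y = 0 := by
  rw [conormal, sub_dotProduct, smul_dotProduct, single_one_dotProduct, smul_eq_mul,
    ← metric_eq_mulVec_dotProduct, metric_comm]
  cases M <;> simp_all [radial_apply, timeCoeff, carrier]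

theorem gramMatrix_mulVec_conormal {y : Ambient d} (hN : M.radial y (N y) = 0) :
    M.gramMatrix d *ᵥ M.conormal N y = N y := by
  have h0 := one_sub_sq_mul_eq_zero hN
  ext i
  by_cases hi : i = 0
  · subst hi
    cases M <;> simp_all [conormal, gramMatrix, mulVec_diagonal, timeCoeff]
  · simp [conormal, gramMatrix, mulVec_diagonal, hi]

theorem contDiffAt_conormal {x : Ambient d} (hN : ContDiffAt ℝ 1 N x) :
    ContDiffAt ℝ 1 (M.conormal N) x := by
  have h1 : ContDiffAt ℝ 1 (fun z => M.metric (N z) z) x :=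
    hN.dotProduct (contDiffAt_id.const_mulVec _)
  exact (hN.const_mulVec _).sub ((h1.mul contDiffAt_const).smul contDiffAt_const)

/-- For this fixed `w` the identity `ν · w = ⟨G N, w⟩` holds at every ambient point, so it can be
differentiated. -/
theorem fderiv_conormal_dotProduct {x w : Ambient d} (hN : ContDiffAt ℝ 1 N x)
    (hw : M.radial x w = 0) (v : Ambient d) :
    fderiv ℝ (M.conormal N) x v ⬝ᵥ w = -M.secondFundamentalForm N x v w := by
  have h1 := (((contDiffAt_conormal (M := M) hN).differentiableAt
    (by norm_num)).hasDerivAt_line v).dotProduct (hasDerivAt_const 0 w)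
  have h2 := ((hN.differentiableAt (by norm_num)).hasDerivAt_line v).dotProduct
    (hasDerivAt_const 0 (M.gramMatrix d *ᵥ w))
  simp only [conormal_dotProduct hw] at h1
  have := h1.unique h2
  simpa [secondFundamentalForm, metric] using this

end SpaceForm

/-! ### Non-degenerate quadrics have invertible matrices. -/

namespace SpaceForm

variable {d : ℕ} {M : SpaceForm}

/-- If the conormal field of `X` keeps annihilating `T_x X` along a line through `x` whose projection
lies in `X`, then the second fundamental form of `X` at `x` is degenerate. -/
theorem HasNondegenerateSecondFormAt.false_of_line {X : Set (Ambient d)} {x v : Ambient d}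
    (h : M.HasNondegenerateSecondFormAt X x) (hX : X ⊆ M.carrier d) (hx : x ∈ X) (hv0 : v ≠ 0)
    (hv : M.radial x v = 0) (hvX : ∀ᶠ s in 𝓝 (0 : ℝ), M.proj (x + s • v) ∈ X)
    (hw : ∀ w ∈ tangentVectors X x, ∀ᶠ s in 𝓝 (0 : ℝ),
      w - M.radial (M.proj (x + s • v)) w • M.proj (x + s • v) ∈
        tangentVectors X (M.proj (x + s • v))) : False := by
  obtain ⟨-, N, ⟨hN, hNX⟩, hII⟩ := h
  refine hv0 (hII v (M.mem_tangentVectors_of_line (hX hx) hv hvX) fun w hwX => ?_)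
  have hrw := M.radial_eq_zero_of_mem_tangentVectors hX (hX hx) hwX
  have hd : HasDerivAt (fun s : ℝ => M.proj (x + s • v)) v 0 := by
    have := M.hasDerivAt_proj (hX hx) (γ := fun s : ℝ => x + s • v) (v := v) (by simp) (by
      simpa using ((hasDerivAt_id (0 : ℝ)).smul_const v).const_add x)
    simpa [hv] using this
  have hT : Tendsto (fun s : ℝ => M.proj (x + s • v)) (𝓝 0) (𝓝[X] x) := by
    rw [tendsto_nhdsWithin_iff]
    exact ⟨by simpa [M.proj_of_mem (hX hx)] using hd.continuousAt.tendsto, hvX⟩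
  -- The conormal annihilates its base point, so subtracting the radial part of `w` does not matter.
  -- Differentiating this identity gives `II(v, w) = 0`.
  have h0 : ∀ᶠ s in 𝓝 (0 : ℝ), M.conormal N (M.proj (x + s • v)) ⬝ᵥ w = 0 := by
    filter_upwards [hT.eventually hNX, hw w hwX, hvX] with s h1 h2 h3
    have h4 := M.radial_eq_zero_of_mem_tangentVectors hX (hX h3) h2
    have h5 := conormal_dotProduct (N := N) h4 (M.proj (x + s • v))
    rw [h1.2.2 _ h2, dotProduct_sub, dotProduct_smul,
      conormal_dotProduct_self (hX h3) (M.mem_tangentSpace_iff.1 h1.1)] at h5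
    simpa using h5
  have h1 : HasFDerivAt (M.conormal N) (fderiv ℝ (M.conormal N) x) (M.proj (x + (0 : ℝ) • v)) := by
    simpa [M.proj_of_mem (hX hx)] using
      ((contDiffAt_conormal (M := M) hN).differentiableAt (by norm_num)).hasFDerivAt
  have h2 := ((h1.comp_hasDerivAt 0 hd).dotProduct (hasDerivAt_const 0 w)).unique
    ((hasDerivAt_const 0 (0 : ℝ)).congr_of_eventuallyEq h0)
  have h3 := fderiv_conormal_dotProduct hN hrw v
  rw [dotProduct_zero, add_zero] at h2
  linarith

variable {Q : Matrix (Fin (d + 1)) (Fin (d + 1)) ℝ}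

theorem quadric_subset : M.quadric Q ⊆ M.carrier d := fun _ h => h.1

theorem radial_sub_radial_smul {p : Ambient d} (hp : p ∈ M.carrier d) (w : Ambient d) :
    M.radial p (w - M.radial p w • p) = 0 := by
  simp [M.radial_self hp]

/-- A quadric that has a singular point has no non-degenerate second fundamental form there. -/
theorem mulVec_ne_zero_of_nondegenerate (hd : 3 ≤ d) (hQ : Q.IsSymm) {A : Ambient d}
    (hA : A ∈ M.quadric Q) (h : M.HasNondegenerateSecondFormAt (M.quadric Q) A) :
    Q *ᵥ A ≠ 0 := by
  intro hQA
  obtain ⟨F, hF, hF', hFX, -⟩ := h.1.exists_defining_function hA.1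
  have hFA : F A = 0 := hFX.self_of_nhds.2 (by rwa [M.proj_of_mem hA.1])
  have hFd := hF.differentiableAt (by norm_num)
  -- As `Q A = 0`, the form of `Q` along the curve `r (A + s u)` in the quadric equals that of the
  -- increment from `A`; dividing by `s ^ 2` and letting `s → 0` gives the value at `u`. So `Q` is
  -- null on a whole hyperplane, and the quadric contains lines along which `T_A` stays tangent.
  have hnull : ∀ u, fderiv ℝ F A u = 0 → (Q *ᵥ u) ⬝ᵥ u = 0 := by
    intro u hu
    obtain ⟨r, hr, hrA, hrF, C, hC⟩ := exists_retraction hF hFA hF'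
    have hrd := hr.differentiableAt (by norm_num)
    have h1 := hrd.hasDerivAt_line u
    rw [fderiv_retraction_apply hFd hFA hrd hrA hC hu] at h1
    have h2 := hasDerivAt_iff_tendsto_slope_zero.1 h1
    have h3 : Tendsto (fun x => Q *ᵥ x) (𝓝 u) (𝓝 (Q *ᵥ u)) :=
      (Continuous.matrix_mulVec continuous_const continuous_id).tendsto u
    refine tendsto_nhds_unique ((h3.comp h2).dotProduct h2) ?_
    refine Tendsto.congr' ?_ tendsto_const_nhds
    have hT : Tendsto r (𝓝 A) (𝓝 A) := by simpa [hrA] using hr.continuousAt.tendsto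
    have h4 : ∀ᶠ z in 𝓝 A, (Q *ᵥ r z) ⬝ᵥ r z = 0 := by
      filter_upwards [hT.eventually hFX, hrF,
        hT.eventually (M.eventually_proj_mem_quadric_iff Q hA.1)] with z e1 e2 e3
      exact e3.1 (e1.1 e2)
    filter_upwards [((tendsto_line A u).eventually h4).filter_mono nhdsWithin_le_nhds] with s hs
    simp only [Function.comp, zero_add, zero_smul, add_zero, hrA, mulVec_smul, mulVec_sub, hQA,
      sub_zero, smul_dotProduct, dotProduct_smul, dotProduct_sub, hs]
    rw [hQ.mulVec_dotProduct_comm, hQA]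
    simp
  have hpol : ∀ u w, fderiv ℝ F A u = 0 → fderiv ℝ F A w = 0 → (Q *ᵥ u) ⬝ᵥ w = 0 := by
    intro u w hu hw
    have h1 := hnull (u + w) (by simp [hu, hw])
    have h2 := hnull u hu
    have h3 := hnull w hw
    rw [mulVec_add, add_dotProduct, dotProduct_add, dotProduct_add, h2, h3,
      hQ.mulVec_dotProduct_comm w, dotProduct_comm w] at h1
    linarith
  obtain ⟨v, hv, hvF, hv0⟩ := exists_mem_ker_inf_ker_notMem (M.radial A)
    (fderiv ℝ F A).toLinearMap ⊥ (by simp; omega)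
  replace hvF : fderiv ℝ F A v = 0 := hvF
  replace hv0 : v ≠ 0 := hv0
  have hvA : ∀ᶠ s in 𝓝 (0 : ℝ), M.proj (A + s • v) ∈ M.quadric Q := by
    filter_upwards [(tendsto_line A v).eventually (M.eventually_proj_mem_quadric_iff Q hA.1)]
      with s hs
    rw [hs, mulVec_add, hQA, mulVec_smul, zero_add, smul_dotProduct, dotProduct_add,
      hQ.mulVec_dotProduct_comm, hQA, dotProduct_smul, hnull v hvF]
    simp
  refine h.false_of_line quadric_subset hA hv0 hv hvA fun w hw => ?_
  have hwF : fderiv ℝ F A w = 0 := by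
    obtain ⟨γ, hγ0, hγ, hγX⟩ := hw
    have h1 : HasFDerivAt F (fderiv ℝ F A) (γ 0) := by rw [hγ0]; exact hFd.hasFDerivAt
    have hT : Tendsto γ (𝓝 0) (𝓝 A) := by simpa [hγ0] using hγ.continuousAt.tendsto
    refine (h1.comp_hasDerivAt 0 hγ).unique
      ((hasDerivAt_const 0 (0 : ℝ)).congr_of_eventuallyEq ?_)
    filter_upwards [hT.eventually hFX, hγX] with s e1 e2
    exact e1.2 (by rwa [M.proj_of_mem e2.1])
  filter_upwards [hvA] with s hs
  set c := (M.radius (A + s • v))⁻¹ with hc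
  have hp : M.proj (A + s • v) = c • (A + s • v) := rfl
  refine M.mem_tangentVectors_of_line hs.1 (radial_sub_radial_smul hs.1 w) ?_
  filter_upwards [(tendsto_line (M.proj (A + s • v)) _).eventually
    (M.eventually_proj_mem_quadric_iff Q hs.1)] with a ha
  rw [ha]
  generalize M.radial (M.proj (A + s • v)) w = b
  have e1 := hnull v hvF
  have e2 := hnull w hwF
  have e3 := hpol v w hvF hwF
  have e4 := hpol w v hwF hvF
  have e5 : ∀ u, (Q *ᵥ u) ⬝ᵥ A = 0 := fun u => by
    rw [hQ.mulVec_dotProduct_comm, hQA, dotProduct_zero]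
  rw [hp]
  simp only [mulVec_add, mulVec_sub, mulVec_smul, hQA, add_dotProduct, sub_dotProduct,
    smul_dotProduct, dotProduct_add, dotProduct_sub, dotProduct_smul, e1, e2, e3, e4, e5,
    smul_eq_mul]
  simp

/-- A quadric that has a point with non-degenerate second fundamental form is given by an invertible
matrix. -/
theorem det_ne_zero_of_nondegenerate (hd : 3 ≤ d) (hQ : Q.IsSymm) {A : Ambient d}
    (hA : A ∈ M.quadric Q) (h : M.HasNondegenerateSecondFormAt (M.quadric Q) A) :
    Q.det ≠ 0 := by
  intro hdet
  have hQA := mulVec_ne_zero_of_nondegenerate hd hQ hA h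
  obtain ⟨k, hk, hQk⟩ := Matrix.exists_mulVec_eq_zero_iff.2 hdet
  set a := M.radial A k with ha
  have hv0 : k - a • A ≠ 0 := by
    intro h0
    rw [sub_eq_zero] at h0
    have ha0 : a ≠ 0 := by
      intro ha0
      rw [ha0, zero_smul] at h0
      exact hk h0
    rw [h0, mulVec_smul] at hQk
    exact hQA ((smul_eq_zero.1 hQk).resolve_left ha0)
  -- The cone over the quadric is a cylinder in the direction `k`. Moving `A` along the tangential
  -- part of `k` only rescales `Q A`, so the tangent hyperplane of the cone stays fixed.
  have hQs (s : ℝ) : Q *ᵥ (A + s • (k - a • A)) = (1 - s * a) • (Q *ᵥ A) := by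
    rw [mulVec_add, mulVec_smul, mulVec_sub, mulVec_smul, hQk, sub_smul, one_smul, zero_sub,
      smul_neg, smul_smul, sub_eq_add_neg]
  have hkA : (Q *ᵥ A) ⬝ᵥ k = 0 := by
    rw [hQ.mulVec_dotProduct_comm, hQk, dotProduct_zero]
  have hvA : ∀ᶠ s in 𝓝 (0 : ℝ), M.proj (A + s • (k - a • A)) ∈ M.quadric Q := by
    filter_upwards [(tendsto_line A (k - a • A)).eventually
      (M.eventually_proj_mem_quadric_iff Q hA.1)] with s hs
    rw [hs, hQs]
    simp [dotProduct_add, dotProduct_sub, hkA, hA.2]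
  refine h.false_of_line quadric_subset hA hv0 (radial_sub_radial_smul hA.1 k) hvA fun w hw => ?_
  have hQw := M.mulVec_dotProduct_eq_zero_of_mem_tangentVectors hQ hw
  have h1 : ∀ᶠ s in 𝓝 (0 : ℝ), 1 - s * a ≠ 0 := by
    have : ContinuousAt (fun s : ℝ => 1 - s * a) 0 := by fun_prop
    exact this.eventually_ne (by simp)
  filter_upwards [hvA, h1, (tendsto_line A (k - a • A)).eventually
    (M.eventually_radius_ne_zero hA.1)] with s hs hs1 hs2
  have hQp : Q *ᵥ M.proj (A + s • (k - a • A)) =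
      ((M.radius (A + s • (k - a • A)))⁻¹ * (1 - s * a)) • (Q *ᵥ A) := by
    rw [proj, mulVec_smul, hQs, smul_smul]
  refine M.mem_tangentVectors_quadric hQ hs ?_ (radial_sub_radial_smul hs.1 w) ?_
  · rw [hQp]
    exact smul_ne_zero (mul_ne_zero (inv_ne_zero hs2) hs1) hQA
  · rw [dotProduct_sub, dotProduct_smul, hs.2, hQp, smul_dotProduct, hQw]
    simp

/-! ### The circumscribed cone and the consequence of its symmetry. -/

/-- The bilinear form on the ambient space whose null vectors are those of the tangent planes through
`y` to the cone over the quadric of `Q`. -/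
def coneForm (Q : Matrix (Fin (d + 1)) (Fin (d + 1)) ℝ) (y : Ambient d) :
    Ambient d →ₗ[ℝ] Ambient d →ₗ[ℝ] ℝ :=
  LinearMap.mk₂ ℝ (fun u w => ((Q *ᵥ y) ⬝ᵥ y) * ((Q *ᵥ u) ⬝ᵥ w) -
      ((Q *ᵥ y) ⬝ᵥ u) * ((Q *ᵥ y) ⬝ᵥ w))
    (fun _ _ _ => by simp only [mulVec_add, add_dotProduct, dotProduct_add]; ring)
    (fun _ _ _ => by simp only [mulVec_smul, smul_dotProduct, dotProduct_smul, smul_eq_mul]; ring)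
    (fun _ _ _ => by simp only [dotProduct_add]; ring)
    (fun _ _ _ => by simp only [dotProduct_smul, smul_eq_mul]; ring)

theorem coneForm_apply (Q : Matrix (Fin (d + 1)) (Fin (d + 1)) ℝ) (y u w : Ambient d) :
    coneForm Q y u w = ((Q *ᵥ y) ⬝ᵥ y) * ((Q *ᵥ u) ⬝ᵥ w) -
      ((Q *ᵥ y) ⬝ᵥ u) * ((Q *ᵥ y) ⬝ᵥ w) := rfl

theorem coneForm_comm (hQ : Q.IsSymm) (y u w : Ambient d) :
    coneForm Q y u w = coneForm Q y w u := by
  rw [coneForm_apply, coneForm_apply, hQ.mulVec_dotProduct_comm u, dotProduct_comm u]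
  ring

theorem coneForm_self_left (y w : Ambient d) : coneForm Q y y w = 0 := by
  rw [coneForm_apply]; ring

theorem coneForm_self_right (hQ : Q.IsSymm) (y w : Ambient d) : coneForm Q y w y = 0 := by
  rw [coneForm_comm hQ, coneForm_self_left]

/-- If a geodesic through `y` is tangent to the quadric of `Q`, then its tangency point is a null
vector of `Q` that is orthogonal to `y`. -/
theorem IsTangentGeodesic.exists_point (hQ : Q.IsSymm) {P : Submodule ℝ (Ambient d)}
    (hP : M.IsTangentGeodesic P (M.quadric Q)) :
    ∃ A ∈ P, A ∈ M.quadric Q ∧ ∀ w ∈ P, (Q *ᵥ A) ⬝ᵥ w = 0 := by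
  obtain ⟨-, A, hAM, hAP, hAU, hA⟩ := hP
  refine ⟨A, hAP, hAU, fun w hw => ?_⟩
  have h1 := hA (w - M.radial A w • A) (P.sub_mem hw (P.smul_mem _ hAP))
    (M.mem_tangentSpace_iff.2 (radial_sub_radial_smul hAM w))
  have h2 := M.mulVec_dotProduct_eq_zero_of_mem_tangentVectors hQ h1
  rw [dotProduct_sub, dotProduct_smul, hAU.2] at h2
  simpa using h2

/-- The plane of the geodesic is spanned by `y` and the tangency point `A`. The form kills `y`, and
it is zero on `A` because `A` is `Q`-null and `Q`-orthogonal to `y`. -/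
theorem coneForm_eq_zero_of_mem_circumscribedCone (hQ : Q.IsSymm) {y v : Ambient d}
    (hy : (Q *ᵥ y) ⬝ᵥ y ≠ 0) (hv : v ∈ M.circumscribedCone (M.quadric Q) y) :
    coneForm Q y v v = 0 := by
  obtain ⟨-, P, hyP, hvP, hP⟩ := hv
  obtain ⟨A, hAP, hAU, hA⟩ := hP.exists_point hQ
  have hA0 : A ≠ 0 := M.ne_zero_of_mem_carrier hAU.1
  have hli : LinearIndependent ℝ ![y, A] := by
    rw [LinearIndependent.pair_iff]
    intro a b hab
    have h1 := hA y hyP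
    have h2 : (Q *ᵥ y) ⬝ᵥ (a • y + b • A) = 0 := by rw [hab, dotProduct_zero]
    rw [dotProduct_add, dotProduct_smul, dotProduct_smul, hQ.mulVec_dotProduct_comm y A,
      dotProduct_comm y, h1] at h2
    have ha : a = 0 := by simpa [hy] using h2
    subst ha
    simpa [hA0] using hab
  have hspan : Submodule.span ℝ {y, A} = P := by
    refine Submodule.eq_of_le_of_finrank_eq ?_ ?_
    · rw [Submodule.span_le]
      rintro x (rfl | rfl) <;> assumption
    · have := finrank_span_eq_card hli
      rw [Matrix.range_cons_cons_empty, Fintype.card_fin] at this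
      rw [hP.1, this]
  rw [← hspan, Submodule.mem_span_pair] at hvP
  obtain ⟨a, b, rfl⟩ := hvP
  have h1 := hA y hyP
  have h2 : (Q *ᵥ y) ⬝ᵥ A = 0 := by
    rw [hQ.mulVec_dotProduct_comm, dotProduct_comm, h1]
  simp only [map_add, map_smul, LinearMap.add_apply, LinearMap.smul_apply, coneForm_self_left,
    coneForm_self_right hQ, smul_eq_mul]
  rw [coneForm_apply, hAU.2, h2]
  ring

theorem mem_circumscribedCone (hQ : Q.IsSymm) (hdet : Q.det ≠ 0) {y A : Ambient d}
    (hyM : y ∈ M.carrier d) (hy : (Q *ᵥ y) ⬝ᵥ y ≠ 0) (hA : A ∈ M.quadric Q)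
    (hAy : (Q *ᵥ A) ⬝ᵥ y = 0) :
    A - M.radial y A • y ∈ M.circumscribedCone (M.quadric Q) y := by
  have hA0 : A ≠ 0 := M.ne_zero_of_mem_carrier hA.1
  have hQA : Q *ᵥ A ≠ 0 := fun h0 => hA0 (Matrix.eq_zero_of_mulVec_eq_zero hdet h0)
  have hli : LinearIndependent ℝ ![y, A] := by
    rw [LinearIndependent.pair_iff]
    intro a b hab
    have h2 : (Q *ᵥ y) ⬝ᵥ (a • y + b • A) = 0 := by rw [hab, dotProduct_zero]
    rw [dotProduct_add, dotProduct_smul, dotProduct_smul, hQ.mulVec_dotProduct_comm y A,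
      dotProduct_comm y, hAy] at h2
    have ha : a = 0 := by simpa [hy] using h2
    subst ha
    simpa [hA0] using hab
  have hyP : y ∈ Submodule.span ℝ {y, A} := Submodule.subset_span (by simp)
  have hAP : A ∈ Submodule.span ℝ {y, A} := Submodule.subset_span (by simp)
  refine ⟨M.mem_tangentSpace_iff.2 (radial_sub_radial_smul hyM A), Submodule.span ℝ {y, A}, hyP,
    Submodule.sub_mem _ hAP (Submodule.smul_mem _ _ hyP), ?_, A, hA.1, hAP, hA, ?_⟩
  · have := finrank_span_eq_card hli
    rwa [Matrix.range_cons_cons_empty, Fintype.card_fin] at this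
  · intro w hw hwT
    refine M.mem_tangentVectors_quadric hQ hA hQA (M.mem_tangentSpace_iff.1 hwT) ?_
    obtain ⟨a, b, rfl⟩ := Submodule.mem_span_pair.1 hw
    rw [dotProduct_add, dotProduct_smul, dotProduct_smul, hAy, hA.2]
    simp

/-- The tangency points of the geodesics through a point `y` persist when `y` moves. -/
theorem eventually_exists_tangency_point (hQ : Q.IsSymm) {B A : Ambient d}
    (hB : (Q *ᵥ B) ⬝ᵥ B ≠ 0) (hA : A ∈ M.quadric Q) (hAB : (Q *ᵥ A) ⬝ᵥ B = 0) :
    ∀ᶠ y in 𝓝 B, ∃ A' ∈ M.quadric Q, (Q *ᵥ A') ⬝ᵥ y = 0 := by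
  have hqc : Continuous fun y : Ambient d => (Q *ᵥ y) ⬝ᵥ y :=
    (Continuous.matrix_mulVec continuous_const continuous_id).dotProduct continuous_id
  set s : Ambient d → ℝ := fun y => √(((Q *ᵥ B) ⬝ᵥ B) / ((Q *ᵥ y) ⬝ᵥ y)) with hs
  have hsc : ContinuousAt s B := (continuousAt_const.div hqc.continuousAt hB).sqrt
  have hsB : s B = 1 := by simp [hs, hB]
  set w : Ambient d → Ambient d := fun y => B + s y • y with hw
  have hwc : ContinuousAt w B := continuousAt_const.add (hsc.smul continuousAt_id)
  have hwB : (Q *ᵥ w B) ⬝ᵥ w B ≠ 0 := by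
    simp only [hw, hsB, one_smul, mulVec_add, add_dotProduct, dotProduct_add]
    intro h0
    apply hB
    linarith
  have hqw : ContinuousAt (fun y => (Q *ᵥ w y) ⬝ᵥ w y) B := hqc.continuousAt.comp hwc
  -- The image of `A` under the `Q`-reflection along `w y`. Since `s y • y` has the same `Q`-value
  -- as `B`, this reflection exchanges `B` with `-s y • y`; hence it takes a null vector orthogonal
  -- to `B` to one orthogonal to `y`.
  set f : Ambient d → Ambient d := fun y =>
    A - (2 * s y * ((Q *ᵥ A) ⬝ᵥ y) / ((Q *ᵥ w y) ⬝ᵥ w y)) • w y with hf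
  have hAc : ContinuousAt (fun y : Ambient d => (Q *ᵥ A) ⬝ᵥ y) B :=
    (continuous_const.dotProduct continuous_id).continuousAt
  have hfc : ContinuousAt f B := continuousAt_const.sub
    ((((continuousAt_const.mul hsc).mul hAc).div hqw hwB).smul hwc)
  have hfB : f B = A := by simp [hf, hAB]
  have hfT : Tendsto f (𝓝 B) (𝓝 A) := by simpa [hfB] using hfc.tendsto
  have hdiv : ContinuousAt (fun y => ((Q *ᵥ B) ⬝ᵥ B) / ((Q *ᵥ y) ⬝ᵥ y)) B :=
    continuousAt_const.div hqc.continuousAt hB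
  filter_upwards [hfT.eventually (M.eventually_proj_mem_quadric_iff Q hA.1),
    hqw.eventually_ne hwB, hqc.continuousAt.eventually_ne hB,
    hdiv.eventually (lt_mem_nhds (a := 0) (by simp [hB]))] with y h1 h2 h3 h4
  have hss : s y * s y * ((Q *ᵥ y) ⬝ᵥ y) = (Q *ᵥ B) ⬝ᵥ B := by
    rw [hs, Real.mul_self_sqrt h4.le, div_mul_cancel₀ _ h3]
  have hyB : (Q *ᵥ y) ⬝ᵥ B = (Q *ᵥ B) ⬝ᵥ y := by
    rw [hQ.mulVec_dotProduct_comm, dotProduct_comm]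
  have hBA : (Q *ᵥ B) ⬝ᵥ A = 0 := by rw [hQ.mulVec_dotProduct_comm, dotProduct_comm, hAB]
  have hyA : (Q *ᵥ y) ⬝ᵥ A = (Q *ᵥ A) ⬝ᵥ y := by
    rw [hQ.mulVec_dotProduct_comm, dotProduct_comm]
  have hww : (Q *ᵥ w y) ⬝ᵥ w y = 2 * (((Q *ᵥ B) ⬝ᵥ B) + s y * ((Q *ᵥ B) ⬝ᵥ y)) := by
    simp only [hw, mulVec_add, mulVec_smul, add_dotProduct, dotProduct_add, smul_dotProduct,
      dotProduct_smul, smul_eq_mul, hyB]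
    linear_combination hss
  have hwy : s y * ((Q *ᵥ w y) ⬝ᵥ y) = ((Q *ᵥ w y) ⬝ᵥ w y) / 2 := by
    rw [hww]
    simp only [hw, mulVec_add, mulVec_smul, add_dotProduct, smul_dotProduct, smul_eq_mul]
    linear_combination hss
  have hwA : (Q *ᵥ w y) ⬝ᵥ A = s y * ((Q *ᵥ A) ⬝ᵥ y) := by
    simp only [hw, mulVec_add, mulVec_smul, add_dotProduct, smul_dotProduct, smul_eq_mul, hBA, hyA,
      zero_add]
  have hAw : (Q *ᵥ A) ⬝ᵥ w y = s y * ((Q *ᵥ A) ⬝ᵥ y) := by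
    rw [← hwA, hQ.mulVec_dotProduct_comm, dotProduct_comm]
  set q := (Q *ᵥ w y) ⬝ᵥ w y with hq
  have hfy : f y = A - (2 * s y * ((Q *ᵥ A) ⬝ᵥ y) / q) • w y := rfl
  refine ⟨M.proj (f y), h1.2 ?_, ?_⟩
  · rw [hfy]
    simp only [mulVec_sub, mulVec_smul, sub_dotProduct, dotProduct_sub, smul_dotProduct,
      dotProduct_smul, smul_eq_mul, hwA, hAw, hA.2, ← hq]
    field_simp
    ring
  · rw [proj, mulVec_smul, smul_dotProduct, hfy]
    simp only [mulVec_sub, mulVec_smul, sub_dotProduct, smul_dotProduct, smul_eq_mul]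
    have : 2 * s y * ((Q *ᵥ A) ⬝ᵥ y) / q * ((Q *ᵥ w y) ⬝ᵥ y) = (Q *ᵥ A) ⬝ᵥ y := by
      rw [div_mul_eq_mul_div, div_eq_iff h2]
      linear_combination 2 * ((Q *ᵥ A) ⬝ᵥ y) * hwy
    rw [this]
    ring

/-- If the cone at `y` that is circumscribed about the quadric of `Q` is symmetric with respect to the
hyperplane `H` with unit normal `N y`, then the conormal is principal for `Q⁻¹` and the metric. -/
theorem exists_inv_mulVec_conormal_eq (hd : 3 ≤ d) (hQ : Q.IsSymm) (hdet : Q.det ≠ 0)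
    {N : Ambient d → Ambient d} {y A : Ambient d} {H : Set (Ambient d)} (hyM : y ∈ M.carrier d)
    (hy : (Q *ᵥ y) ⬝ᵥ y ≠ 0) (hA : A ∈ M.quadric Q) (hAy : (Q *ᵥ A) ⬝ᵥ y = 0)
    (hN : M.radial y (N y) = 0) (hN1 : M.metric (N y) (N y) = 1)
    (hNH : ∀ b ∈ H, M.metric (N y) b = 0)
    (hH : ∀ a, M.radial y a = 0 → M.conormal N y ⬝ᵥ a = 0 → a ∈ H)
    (hs : M.IsSymmetricWrt y (M.circumscribedCone (M.quadric Q) y) H) :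
    ∃ l c : ℝ, Q⁻¹ *ᵥ M.conormal N y =
      l • (M.gramMatrix d *ᵥ M.conormal N y) + c • y := by
  set ν := M.conormal N y with hν
  set n := N y with hn
  have hνy : ν ⬝ᵥ y = 0 := conormal_dotProduct_self hyM hN
  have hνn : ν ⬝ᵥ n = 1 := by rw [hν, conormal_dotProduct hN, hN1]
  set b := coneForm Q y with hb
  have hby (w) : b w y = 0 := coneForm_self_right hQ y w
  have hbc (u w) : b u w = b w u := coneForm_comm hQ y u w
  set l : Ambient d →ₗ[ℝ] ℝ := dotProductBilin ℝ ℝ ν with hl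
  have hl' (u) : l u = ν ⬝ᵥ u := rfl
  set m : Ambient d →ₗ[ℝ] ℝ := b n - b n n • l with hm
  have hm' (u) : m u = b n u - b n n * (ν ⬝ᵥ u) := rfl
  have hA0 : A ≠ 0 := M.ne_zero_of_mem_carrier hA.1
  have hQA : Q *ᵥ A ≠ 0 := fun h0 => hA0 (Matrix.eq_zero_of_mulVec_eq_zero hdet h0)
  have hyA : (Q *ᵥ y) ⬝ᵥ A = 0 := by rw [hQ.mulVec_dotProduct_comm, dotProduct_comm, hAy]
  have hbA : b A ≠ 0 := by
    intro h0
    have h1 : b A (Q *ᵥ A) = 0 := by rw [h0, LinearMap.zero_apply]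
    rw [hb, coneForm_apply, hyA, zero_mul, sub_zero] at h1
    simp [hy, hQA] at h1
  have hker : ∀ u, b u = 0 → ∃ a : ℝ, u = a • y := by
    intro u hu
    refine ⟨((Q *ᵥ y) ⬝ᵥ u) / ((Q *ᵥ y) ⬝ᵥ y), ?_⟩
    rw [← sub_eq_zero]
    refine Matrix.eq_zero_of_mulVec_eq_zero hdet ?_
    set x := Q *ᵥ (u - (((Q *ᵥ y) ⬝ᵥ u) / ((Q *ᵥ y) ⬝ᵥ y)) • y) with hx
    rw [← dotProduct_self_eq_zero]
    nth_rewrite 1 [hx]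
    have h1 : b u x = 0 := by rw [hu, LinearMap.zero_apply]
    rw [hb, coneForm_apply] at h1
    rw [mulVec_sub, mulVec_smul, sub_dotProduct, smul_dotProduct, smul_eq_mul]
    field_simp
    linear_combination h1
  -- Modulo the kernel line of `b`, a null `v` near `A` may be taken `Q`-orthogonal to `y`, hence
  -- `Q`-null. Being near `A`, it projects centrally to the space form and gives a genuine tangency
  -- point, to which the symmetry hypothesis applies.
  have hev : ∀ᶠ v in 𝓝 A, b v v = 0 → l v * m v = 0 := by
    set g : Ambient d → Ambient d := fun v => v - (((Q *ᵥ y) ⬝ᵥ v) / ((Q *ᵥ y) ⬝ᵥ y)) • y with hg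
    have hgc : Continuous g := continuous_id.sub
      (((continuous_const.dotProduct continuous_id).div_const _).smul continuous_const)
    have hgA : Tendsto g (𝓝 A) (𝓝 A) := by
      have := hgc.tendsto A
      simpa [hg, hyA] using this
    filter_upwards [hgA.eventually (M.eventually_proj_mem_quadric_iff Q hA.1),
      hgA.eventually (M.eventually_radius_ne_zero hA.1)] with v h1 h2 h3
    have hyg : (Q *ᵥ y) ⬝ᵥ g v = 0 := by
      simp only [hg, dotProduct_sub, dotProduct_smul, smul_eq_mul]
      field_simp; ring
    have hgy : (Q *ᵥ g v) ⬝ᵥ y = 0 := by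
      rw [hQ.mulVec_dotProduct_comm, dotProduct_comm, hyg]
    have hbg : b (g v) (g v) = 0 := by
      simp only [hg, map_sub, map_smul, LinearMap.sub_apply, LinearMap.smul_apply, hby, h3]
      rw [hbc y, hby]
      simp
    rw [hb, coneForm_apply, hyg, mul_zero, sub_zero] at hbg
    have hgQ := h1.2 ((mul_eq_zero.1 hbg).resolve_left hy)
    set A' := M.proj (g v) with hA'
    have hA'y : (Q *ᵥ A') ⬝ᵥ y = 0 := by
      rw [hA', proj, mulVec_smul, smul_dotProduct, hgy, smul_zero]
    have hK := mem_circumscribedCone hQ hdet hyM hy hgQ hA'y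
    have hτ := radial_sub_radial_smul hyM A'
    set w := A' - M.radial y A' • y with hw
    have hνw : ν ⬝ᵥ (w - (ν ⬝ᵥ w) • n) = 0 := by
      rw [dotProduct_sub, dotProduct_smul, hνn, smul_eq_mul, mul_one, sub_self]
    have hτa : M.radial y (w - (ν ⬝ᵥ w) • n) = 0 := by
      rw [map_sub, map_smul, hτ, hN, smul_zero, sub_zero]
    have hτn : (ν ⬝ᵥ w) • n ∈ M.tangentSpace y := by
      rw [mem_tangentSpace_iff, map_smul, hN, smul_zero]
    have hiff := hs _ (hH _ hτa hνw) _ hτn (fun c hc => by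
      have := M.metric_smul_smul (ν ⬝ᵥ w) 1 n c
      rw [hNH c hc] at this
      simpa using this)
    rw [sub_add_cancel] at hiff
    have h4 := coneForm_eq_zero_of_mem_circumscribedCone hQ hy hK
    have h5 := coneForm_eq_zero_of_mem_circumscribedCone hQ hy (hiff.1 hK)
    rw [← hb] at h4 h5
    simp only [map_sub, map_smul, LinearMap.sub_apply, LinearMap.smul_apply, h4, hbc w n,
      smul_eq_mul] at h5
    have hνwv : ν ⬝ᵥ w = (M.radius (g v))⁻¹ * (ν ⬝ᵥ v) := by
      simp only [hw, hA', proj, hg, dotProduct_sub, dotProduct_smul, hνy, smul_eq_mul]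
      ring
    have hbwv : b n w = (M.radius (g v))⁻¹ * b n v := by
      simp only [hw, hA', proj, hg, map_sub, map_smul, hby, smul_eq_mul]
      ring
    rw [hνwv, hbwv] at h5
    rw [hl', hm']
    -- The `b`-value of the reflected vector is `-4 (ν · w) (b n w - b n n (ν · w))`, whence the
    -- factor `-1 / 4`.
    have h6 : ((M.radius (g v))⁻¹ * (M.radius (g v))⁻¹) *
        (ν ⬝ᵥ v * (b n v - b n n * ν ⬝ᵥ v)) = 0 := by linear_combination (-1 / 4) * h5
    refine (mul_eq_zero.1 h6).resolve_left ?_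
    exact mul_ne_zero (inv_ne_zero h2) (inv_ne_zero h2)
  have hbAA : b A A = 0 := by
    rw [hb, coneForm_apply, hA.2, hyA]; ring
  have hm0 : m = 0 := by
    refine (eq_zero_or_eq_zero_of_mul_eq_zero_on_null b hbc y hker (by simp; omega) hbAA hbA l m
      hev).resolve_left fun h0 => ?_
    have := congrArg (fun f => f n) h0
    simp [hl', hνn] at this
  set q := (Q *ᵥ y) ⬝ᵥ y with hq
  set μ := b n n with hμ
  have hvec : q • (Q *ᵥ n) - ((Q *ᵥ y) ⬝ᵥ n) • (Q *ᵥ y) = μ • ν := by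
    apply dotProduct_eq
    intro u
    have h1 : m u = 0 := by rw [hm0, LinearMap.zero_apply]
    rw [hm', hb, coneForm_apply] at h1
    simp only [sub_dotProduct, smul_dotProduct, smul_eq_mul]
    linarith
  have hinv : ∀ x, Q⁻¹ *ᵥ (Q *ᵥ x) = x := fun x => by
    rw [mulVec_mulVec, nonsing_inv_mul _ (isUnit_iff_ne_zero.2 hdet), one_mulVec]
  have hvec' := congrArg (fun x => Q⁻¹ *ᵥ x) hvec
  simp only [mulVec_sub, mulVec_smul, hinv] at hvec'
  -- If `μ = 0`, then `q n` is a multiple of `y`; pairing with `ν` gives `q = 0`, but `y` is not on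
  -- the quadric.
  have hμ0 : μ ≠ 0 := by
    intro h0
    rw [h0, zero_smul, sub_eq_zero] at hvec'
    have h1 := congrArg (fun x => ν ⬝ᵥ x) hvec'
    simp only [dotProduct_smul, hνn, hνy, smul_eq_mul] at h1
    apply hy
    linarith
  refine ⟨μ⁻¹ * q, -(μ⁻¹ * ((Q *ᵥ y) ⬝ᵥ n)), ?_⟩
  rw [hν, gramMatrix_mulVec_conormal hN, ← hν, ← hn, mul_smul, neg_smul, mul_smul,
    ← sub_eq_add_neg, ← smul_sub, hvec', smul_smul, inv_mul_cancel₀ hμ0, one_smul]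

end SpaceForm

/-! ### From the conormal equation to the confocal quadric. -/

namespace SpaceForm

variable {d : ℕ} {M : SpaceForm} {Q : Matrix (Fin (d + 1)) (Fin (d + 1)) ℝ}

/-- The inverse of the matrix of a non-empty quadric is not a multiple of the Gram matrix. -/
theorem inv_ne_smul_gramMatrix (hdet : Q.det ≠ 0) {A : Ambient d}
    (hA : A ∈ M.quadric Q) (t : ℝ) : Q⁻¹ ≠ t • M.gramMatrix d := by
  intro h
  have h1 : A = t • (M.gramMatrix d *ᵥ (Q *ᵥ A)) := by
    rw [← smul_mulVec, ← h, mulVec_mulVec, nonsing_inv_mul _ (isUnit_iff_ne_zero.2 hdet),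
      one_mulVec]
  have hG : ∀ x : Ambient d, (1 - M.timeCoeff ^ 2) * (M.gramMatrix d *ᵥ x) 0 = 0 := by
    intro x
    cases M <;> simp [gramMatrix, mulVec_diagonal, timeCoeff]
  have hGG : ∀ x : Ambient d, M.timeCoeff ≠ 0 →
      M.gramMatrix d *ᵥ (M.gramMatrix d *ᵥ x) = x := by
    intro x hx
    ext i
    by_cases hi : i = 0
    · subst hi
      cases M <;> simp [gramMatrix, mulVec_diagonal, timeCoeff] at hx ⊢
    · simp [gramMatrix, mulVec_diagonal, hi]
  -- From `A = t G Q A`: in the Euclidean case `A 0 = 0`; otherwise `G A = t Q A`, so `⟨G A, A⟩ = t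
  -- (Q A · A) = 0`. Either way `A` cannot lie on the space form.
  have h2 : M.radial A A = 0 := by
    rw [radial_apply]
    have h3 : (1 - M.timeCoeff ^ 2) * A 0 = 0 := by
      rw [h1, Pi.smul_apply, smul_eq_mul, mul_left_comm, hG, mul_zero]
    rw [h3, add_zero]
    by_cases hε : M.timeCoeff = 0
    · rw [hε, zero_mul]
    · have h4 : M.gramMatrix d *ᵥ A = t • (Q *ᵥ A) := by
        conv_lhs => rw [h1]
        rw [mulVec_smul, hGG _ hε]
      rw [metric_eq_mulVec_dotProduct, h4, smul_dotProduct, hA.2]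
      simp
  rw [M.radial_self hA.1] at h2
  exact one_ne_zero h2

/-- The tangent spaces of a hypersurface are the kernels of its conormals in the tangent spaces of the
space form, and the conormals are proportional to the differentials of a defining function. -/
theorem eventually_conormal_eq_smul_fderiv {S : Set (Ambient d)} {B : Ambient d}
    (hSM : S ⊆ M.carrier d) {F : Ambient d → ℝ} (hF : ContDiffAt ℝ 1 F B)
    (hF' : fderiv ℝ F B ≠ 0) (hFS : ∀ᶠ z in 𝓝 B, (F z = 0 ↔ M.proj z ∈ S))
    (hFr : ∀ᶠ y in 𝓝[M.carrier d] B, fderiv ℝ F y y = 0)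
    {N : Ambient d → Ambient d} (hN : M.IsUnitNormalFieldAt S B N) :
    ∀ᶠ y in 𝓝[S] B,
      (∃ κ : ℝ, κ ≠ 0 ∧ ∀ u, M.conormal N y ⬝ᵥ u = κ * fderiv ℝ F y u) ∧
      ∀ v, M.radial y v = 0 → M.conormal N y ⬝ᵥ v = 0 → v ∈ tangentVectors S y := by
  have hle : 𝓝[S] B ≤ 𝓝 B := nhdsWithin_le_nhds
  filter_upwards [hN.2, hFS.eventually_nhds.filter_mono hle,
    (hF.eventually (by norm_num)).filter_mono hle,
    ((hF.continuousAt_fderiv (by norm_num)).eventually_ne hF').filter_mono hle,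
    hFr.filter_mono (nhdsWithin_mono B hSM), self_mem_nhdsWithin]
    with y ⟨hNT, hN1, hNS⟩ h2 h3 h4 h5 hyS
  have hyM := hSM hyS
  rw [mem_tangentSpace_iff] at hNT
  have hFy : F y = 0 := h2.self_of_nhds.2 (by rwa [M.proj_of_mem hyM])
  have htan : ∀ v, M.radial y v = 0 → fderiv ℝ F y v = 0 → v ∈ tangentVectors S y := fun v hv hFv =>
    M.mem_tangentVectors_of_fderiv hyM h3 hFy h4 (h2.mono fun z hz => hz.1) hv hFv
  -- `F` is constant along rays, so a vector in `ker dF` stays in it after removal of its radial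
  -- part. It is then tangent to `S` and killed by the conormal.
  obtain ⟨κ, hκ, hκe⟩ := exists_eq_smul_of_ker_le (φ := (fderiv ℝ F y).toLinearMap)
    (ψ := dotProductBilin ℝ ℝ (M.conormal N y)) (by
      intro u hu
      replace hu : fderiv ℝ F y u = 0 := hu
      have hr := radial_sub_radial_smul hyM u
      have h6 := hNS _ (htan _ hr (by rw [map_sub, map_smul, hu, h5]; simp))
      rw [← conormal_dotProduct (N := N) hr, dotProduct_sub, dotProduct_smul,
        conormal_dotProduct_self hyM hNT] at h6
      simpa using h6) (by
      intro h0
      have h6 : M.conormal N y ⬝ᵥ N y = 0 := congrArg (fun f => f (N y)) h0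
      rw [conormal_dotProduct hNT, hN1] at h6
      exact one_ne_zero h6)
  have hκe' : ∀ u, M.conormal N y ⬝ᵥ u = κ * fderiv ℝ F y u :=
    fun u => congrArg (fun f => f u) hκe
  refine ⟨⟨κ, hκ, hκe'⟩, fun v hv hνv => htan v hv ?_⟩
  rw [hκe'] at hνv
  exact (mul_eq_zero.1 hνv).resolve_left hκ

end SpaceForm

theorem lemma2p12 (M : SpaceForm) (d : ℕ) (hd : 3 ≤ d)
    (U S : Set (SpaceForm.Ambient d)) (B : SpaceForm.Ambient d)
    (hU : M.IsQuadric U)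
    (hUnd : ∀ A ∈ U, M.HasNondegenerateSecondFormAt U A)
    (hSM : S ⊆ M.carrier d) (hBS : B ∈ S) (hBU : B ∉ U)
    (hSnd : M.HasNondegenerateSecondFormAt S B)
    (hcone : (M.circumscribedCone U B).Nonempty)
    (hsymm : ∀ᶠ y in 𝓝[S] B,
      M.IsSymmetricWrt y (M.circumscribedCone U y) (SpaceForm.tangentVectors S y)) :
    ∃ S' : Set (SpaceForm.Ambient d), M.AreConfocal U S' ∧
      ∀ᶠ x in 𝓝[M.carrier d] B, (x ∈ S ↔ x ∈ S') := by
  obtain ⟨Q, hQ, rfl⟩ := hU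
  have hBM := hSM hBS
  have hQB : (Q *ᵥ B) ⬝ᵥ B ≠ 0 := fun h0 => hBU ⟨hBM, h0⟩
  obtain ⟨-, -, P, hBP, -, hP⟩ := hcone
  obtain ⟨A, -, hA, hAP⟩ := hP.exists_point hQ
  have hAB := hAP B hBP
  have hdet := SpaceForm.det_ne_zero_of_nondegenerate hd hQ hA (hUnd A hA)
  obtain ⟨F, hF, hF', hFS, hFr⟩ := hSnd.1.exists_defining_function hBM
  obtain ⟨-, N, hN, hII⟩ := hSnd
  have hle : 𝓝[S] B ≤ 𝓝 B := nhdsWithin_le_nhds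
  have hFB : F B = 0 := hFS.self_of_nhds.2 (by rwa [M.proj_of_mem hBM])
  have hframe := SpaceForm.eventually_conormal_eq_smul_fderiv hSM hF hF' hFS hFr hN
  obtain ⟨rF, hrF, hrB, hrF0, C, hC⟩ := exists_retraction hF hFB hF'
  have hrT : Tendsto rF (𝓝 B) (𝓝 B) := by simpa [hrB] using hrF.continuousAt.tendsto
  have hrS : ∀ᶠ z in 𝓝 B, M.proj (rF z) ∈ S := by
    filter_upwards [hrT.eventually hFS, hrF0] with z h1 h2
    exact h1.1 h2
  set ν := M.conormal N with hν
  have hνc : ContDiffAt ℝ 1 ν B := SpaceForm.contDiffAt_conormal hN.1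
  have hRs : (Q⁻¹).IsSymm := by
    rw [Matrix.IsSymm, transpose_nonsing_inv, hQ.eq]
  have hp : ∀ᶠ y in 𝓝[S] B, ∃ l c : ℝ, Q⁻¹ *ᵥ ν y = l • (M.gramMatrix d *ᵥ ν y) + c • y := by
    have hqc : ContinuousAt (fun y : SpaceForm.Ambient d => (Q *ᵥ y) ⬝ᵥ y) B :=
      ((Continuous.matrix_mulVec continuous_const continuous_id).dotProduct
        continuous_id).continuousAt
    filter_upwards [hsymm, hframe, hN.2, self_mem_nhdsWithin,
      (hqc.eventually_ne hQB).filter_mono hle,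
      (SpaceForm.eventually_exists_tangency_point hQ hQB hA hAB).filter_mono hle]
      with y h1 h2 h3 hyS h4 ⟨A', hA', hA'y⟩
    exact SpaceForm.exists_inv_mulVec_conormal_eq hd hQ hdet (hSM hyS) h4 hA' hA'y
      (M.mem_tangentSpace_iff.1 h3.1) h3.2.1 h3.2.2 h2.2 h1
  have hy : ∀ᶠ y in 𝓝[S] B, ν y ⬝ᵥ y = 0 := by
    filter_upwards [hN.2, self_mem_nhdsWithin] with y h1 hyS
    exact SpaceForm.conormal_dotProduct_self (hSM hyS) (M.mem_tangentSpace_iff.1 h1.1)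
  have hn : ∀ᶠ y in 𝓝[S] B, ν y ⬝ᵥ (M.gramMatrix d *ᵥ ν y) = 1 := by
    filter_upwards [hN.2] with y h1
    have h2 := M.mem_tangentSpace_iff.1 h1.1
    rw [hν, SpaceForm.gramMatrix_mulVec_conormal h2, SpaceForm.conormal_dotProduct h2, h1.2.1]
  have ht : ∀ᶠ y in 𝓝[S] B, ∀ w ∈ SpaceForm.tangentVectors S y, ν y ⬝ᵥ w = 0 := by
    filter_upwards [hN.2, self_mem_nhdsWithin] with y h1 hyS w hw
    rw [hν, SpaceForm.conormal_dotProduct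
      (M.radial_eq_zero_of_mem_tangentVectors hSM (hSM hyS) hw), h1.2.2 w hw]
  have hT : ∀ᶠ y in 𝓝[S] B, ∀ u, ν y ⬝ᵥ u = 0 →
      ∃ a : ℝ, u - a • y ∈ SpaceForm.tangentVectors S y := by
    filter_upwards [hframe, hy, self_mem_nhdsWithin] with y h1 h2 hyS u hu
    refine ⟨M.radial y u, h1.2 _ (SpaceForm.radial_sub_radial_smul (hSM hyS) u) ?_⟩
    rw [dotProduct_sub, dotProduct_smul, hu, h2]
    simp
  set T : Submodule ℝ (SpaceForm.Ambient d) :=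
    LinearMap.ker (M.radial B) ⊓ LinearMap.ker (dotProductBilin ℝ ℝ (ν B)) with hTdef
  have hTS : (T : Set (SpaceForm.Ambient d)) = SpaceForm.tangentVectors S B := by
    ext v
    constructor
    · intro hv
      exact (hframe.self_of_nhdsWithin hBS).2 v hv.1 hv.2
    · intro hv
      exact ⟨M.radial_eq_zero_of_mem_tangentVectors hSM hBM hv,
        ht.self_of_nhdsWithin hBS v hv⟩
  have hT0 : T ≠ ⊥ := by
    obtain ⟨v, hv1, hv2, hv⟩ := exists_mem_ker_inf_ker_notMem (M.radial B)
      (dotProductBilin ℝ ℝ (ν B)) ⊥ (by simp; omega)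
    exact (Submodule.ne_bot_iff T).2 ⟨v, ⟨hv1, hv2⟩, hv⟩
  have hrc : ContDiffAt ℝ 1 (fun z => M.proj (rF z)) B :=
    ContDiffAt.comp (g := M.proj) B (by rw [hrB]; exact M.contDiffAt_proj hBM 1) hrF
  obtain ⟨t, hdt, hc⟩ := SpaceForm.exists_pencil_parameter (r := fun z => M.proj (rF z)) hRs
    (M.gramMatrix_isSymm d) (SpaceForm.inv_ne_smul_gramMatrix hdet hA) hνc
    hrc
    (by simp [hrB, M.proj_of_mem hBM]) hBS (M.ne_zero_of_mem_carrier hBM) hrS (by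
      filter_upwards [hC.filter_mono hle, hFS.filter_mono hle, self_mem_nhdsWithin] with z h1 h2 hzS
      have h3 : F z = 0 := h2.2 (by rwa [M.proj_of_mem (hSM hzS)])
      rw [h3, abs_zero, mul_zero] at h1
      rw [← sub_eq_zero.1 (norm_le_zero_iff.1 h1), M.proj_of_mem (hSM hzS)])
    hy hn hp ht hT T hTS hT0 (by
      intro v hv hvw
      rw [← SetLike.mem_coe, hTS] at hv
      refine hII v hv fun w hw => ?_
      have h1 := SpaceForm.fderiv_conormal_dotProduct hN.1
        (M.radial_eq_zero_of_mem_tangentVectors hSM hBM hw) v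
      rw [← hν, hvw w (by rw [← SetLike.mem_coe, hTS]; exact hw)] at h1
      linarith)
  set A₀ := Q⁻¹ - t • M.gramMatrix d with hA₀
  have hA₀s : (A₀⁻¹).IsSymm := by
    rw [Matrix.IsSymm, transpose_nonsing_inv, (hRs.sub ((M.gramMatrix_isSymm d).smul t)).eq]
  have hc' : ∀ᶠ y in 𝓝[S] B, ∃ c : ℝ, c ≠ 0 ∧ A₀⁻¹ *ᵥ y = c • ν y := by
    filter_upwards [hc, hn] with y ⟨c, h1⟩ h2
    have h3 : ν y = c • (A₀⁻¹ *ᵥ y) := by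
      rw [← mulVec_smul, ← h1, mulVec_mulVec, nonsing_inv_mul _ hdt, one_mulVec]
    have hc0 : c ≠ 0 := by
      rintro rfl
      rw [zero_smul] at h3
      simp [h3] at h2
    exact ⟨c⁻¹, inv_ne_zero hc0, by
      rw [h3, smul_smul, inv_mul_cancel₀ hc0, one_smul]⟩
  have hSg : ∀ᶠ y in 𝓝[S] B, (A₀⁻¹ *ᵥ y) ⬝ᵥ y = 0 := by
    filter_upwards [hc', hy] with y h1 h2
    obtain ⟨c, -, h1⟩ := h1
    rw [h1, smul_dotProduct, h2, smul_zero]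
  obtain ⟨c, hc0, hcB⟩ := hc'.self_of_nhdsWithin hBS
  obtain ⟨κ, hκ, hκB⟩ := (hframe.self_of_nhdsWithin hBS).1
  have hpr : Tendsto (fun z => M.proj (rF z)) (𝓝 B) (𝓝[S] B) :=
    tendsto_nhdsWithin_iff.2 ⟨(M.tendsto_proj hBM).comp hrT, hrS⟩
  -- At `B` the differential of the quadratic form is `2 A₀⁻¹ B = 2 c ν`, and `ν = κ dF`; this is
  -- the factor `2 * c * κ`.
  have hgF := eventually_eq_zero_of_regular (g := fun z => (A₀⁻¹ *ᵥ z) ⬝ᵥ z)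
    (κ := 2 * c * κ) hF ((contDiffAt_id.const_mulVec _).dotProduct contDiffAt_id)
    (by simp [hc0, hκ])
    (by
      ext u
      rw [hA₀s.fderiv_mulVec_dotProduct_self, hcB, smul_dotProduct, hν, hκB]
      simp only [smul_eq_mul, _root_.smul_apply]
      ring) hrF.continuousAt hrB hC hrF0 (by
      filter_upwards [hpr.eventually hSg, hrT.eventually (M.eventually_radius_ne_zero hBM)]
        with z h1 h2
      simpa [SpaceForm.proj, mulVec_smul, h2] using h1)
  -- The pencil is that of `Q⁻¹`: parameter `0` gives back `Q`, that is `U`, and parameter `t` gives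
  -- the new quadric.
  refine ⟨M.quadric A₀⁻¹, ⟨Q⁻¹, hRs, 0, t, ⟨?_, ?_⟩, hdt, rfl⟩, ?_⟩
  · rw [zero_smul, sub_zero, isUnit_nonsing_inv_det_iff]
    exact isUnit_iff_ne_zero.2 hdet
  · rw [zero_smul, sub_zero, nonsing_inv_nonsing_inv _ (isUnit_iff_ne_zero.2 hdet)]
  · filter_upwards [self_mem_nhdsWithin, hgF.filter_mono nhdsWithin_le_nhds,
      hFS.filter_mono nhdsWithin_le_nhds,
      (eventually_nhdsWithin_iff.1 hSg).filter_mono nhdsWithin_le_nhds] with x hxM h1 h2 h3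
    rw [M.proj_of_mem hxM] at h2
    exact ⟨fun hx => ⟨hxM, h3 hx⟩, fun hx => h2.1 (h1 hx.2)⟩
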